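/- Let $d\ge 1$ and let $U\subseteq\mathbb R^d\times\mathbb R^d$ be open (for instance all of $\mathbb R^d\times\mathbb R^d$), with points $z=(p,x)$. Put $\{f,g\}=\nabla_pf\cdot\nabla_xg-\nabla_xf\cdot\nabla_pg$, componentwise for vector-valued functions. Let $A_1=H,A_2,\dots,A_d:U\to\mathbb R$ and $\mathcal B_1,\dots,\mathcal B_d:U\to\mathbb R^3$ be smooth. Suppose that the Hamiltonian flow $\phi_j^t$ of $A_j$ ($\dot p=-\nabla_xA_j$, $\dot x=\nabla_pA_j$) is defined on $U$ for all times, let $d_j(z,t)\in \mathrm{SU}(2)$ solve $\dot d_j(z,t)+\tfrac{i}{2}\,\sigma\cdot\mathcal B_j(\phi_j^t(z))\,d_j(z,t)=0$, $d_j(z,0)=1$, where $\sigma$ is the vector of Pauli matrices, and let $$Y_j^t(z,s)=\bigl(\phi_j^t(z),\varphi(d_j(z,t))s\bigr),\qquad (z,s)\in U\times S^2,$$ where $\varphi:\mathrm{SU}(2)\to \mathrm{SO}(3)$ is the covering map, $g(v\cdot\sigma)g^{-1}=(\varphi(g)v)\cdot\sigma$. Let $Y_{\rm cl}^t=Y_1^t$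 be the classical skew product of Hamiltonian motion and spin precession, and suppose that it is integrable by means of $Y_1^t,\dots,Y_d^t$: for all $j,k$, on $U$, $$\{A_j,A_k\}=0,\qquad \{A_j,\mathcal B_k\}+\{\mathcal B_j,A_k\}-\mathcal B_j\times\mathcal B_k=0 .$$ A Liouville–Arnold torus is a compact connected component $T$ of a common level set $\{z\in U: A_j(z)=a_j,\ j=1,\dots,d\}$ (for instance the whole level set, if it is nonempty, compact and connected) such that $dA_1,\dots,dA_d$ are linearly independent at every point of $T$. Let $\Omega\subseteq U$ be the union of all Liouville–Arnold tori. Then every Liouville–Arnold torus $T$ is a smoothly embedded torus $\mathbb T^d$, and there is a map $n:\Omega\to S^2$, smooth along every Liouville–Arnold torus, such that the sets $$\mathcal T_\theta=\mathcal T_\theta(T)=\{(p,x,s)\in T\times S^2:\ \sphericalangle(s,n(p,x))=\theta\},\qquad 0\le\theta\le\pi,$$ have the following properties. 1. Each $\mathcal T_\theta(T)$ is invariant: $Y_{\rm cl}^t(\mathcal T_\theta)=\mathcal T_\theta$, and $Y_j^t(\mathcal T_\theta)=\mathcal T_\theta$ for all $j=1,\dots,d$ and all $t\in\mathbb R$.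 2. For $0<\theta<\pi$, $\mathcal T_\theta(T)\subset T\times S^2$ with the projection $(p,x,s)\mapsto(p,x)$ is a smooth fibre bundle over $T\cong\mathbb T^d$ with typical fibre $S^1$. (For $\theta=0$ and $\theta=\pi$ the fibres are the single points $n(p,x)$ and $-n(p,x)$.) 3. $\Omega\times S^2$, the part of the combined phase space over the Liouville–Arnold tori, is the disjoint union of the sets $\mathcal T_\theta(T)$ over all Liouville–Arnold tori $T$ and all $\theta\in[0,\pi]$. In particular, if $\Omega=U$, the whole combined phase space $U\times S^2$ is decomposed in this way. -/

import Mathlib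

open scoped ContDiff

namespace SpinPrecession

/-- The translational phase space `ℝ^d × ℝ^d`, with points `z = (p, x)`. -/
abbrev Phase (d : ℕ) : Type := EuclideanSpace ℝ (Fin d) × EuclideanSpace ℝ (Fin d)

/-- The Euclidean space `ℝ³` that contains the classical spin vectors. -/
abbrev Spin : Type := EuclideanSpace ℝ (Fin 3)

/-- The unit sphere `S² ⊆ ℝ³`. -/
def spinSphere : Set Spin := Metric.sphere 0 1

/-- The partial derivative `∂f/∂p_i`. -/
noncomputable def partialP {d : ℕ} (i : Fin d) (f : Phase d → ℝ) (z : Phase d) : ℝ :=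
  fderiv ℝ f z (EuclideanSpace.single i 1, 0)

/-- The partial derivative `∂f/∂x_i`. -/
noncomputable def partialX {d : ℕ} (i : Fin d) (f : Phase d → ℝ) (z : Phase d) : ℝ :=
  fderiv ℝ f z (0, EuclideanSpace.single i 1)

/-- The Poisson bracket `{f, g} = ∇_p f · ∇_x g - ∇_x f · ∇_p g`, whose sign is such that
`{H, g}` is the derivative of `g` along the Hamiltonian flow of `H`. -/
noncomputable def poisson {d : ℕ} (f g : Phase d → ℝ) (z : Phase d) : ℝ :=
  ∑ i, (partialP i f z * partialX i g z - partialX i f z * partialP i g z)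

/-- The Hamiltonian vector field: `p' = -∂H/∂x`, `x' = ∂H/∂p`. -/
noncomputable def hamiltonianVectorField {d : ℕ} (H : Phase d → ℝ) (z : Phase d) : Phase d :=
  (WithLp.toLp 2 fun i => -partialX i H z, WithLp.toLp 2 fun i => partialP i H z)

/-- The Pauli matrices. -/
noncomputable def pauli : Fin 3 → Matrix (Fin 2) (Fin 2) ℂ :=
  ![!![0, 1; 1, 0], !![0, -Complex.I; Complex.I, 0], !![1, 0; 0, -1]]

/-- The matrix `v · σ` for a vector `v ∈ ℝ³`. -/
noncomputable def sigmaDot (v : Spin) : Matrix (Fin 2) (Fin 2) ℂ :=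
  ∑ a, (v a : ℂ) • pauli a

/-- The group `SU(2)`. -/
abbrev SU2 : Type := Matrix.specialUnitaryGroup (Fin 2) ℂ

/-- The covering map `SU(2) → SO(3)`, written as an action on `ℝ³`: the components of
`g (v · σ) g⁻¹` in the basis of the Pauli matrices (see `sigmaDot_cover`). -/
noncomputable def cover (g : SU2) (v : Spin) : Spin :=
  WithLp.toLp 2 fun a =>
    (1 / 2 : ℝ) * (Matrix.trace (pauli a * (g.1 * sigmaDot v * star g.1))).re

/-- The defining property of the covering map: `(cover g v) · σ = g (v · σ) g⁻¹`. -/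
theorem sigmaDot_cover (g : SU2) (v : Spin) :
    sigmaDot (cover g v) = g.1 * sigmaDot v * star g.1 := by
  have h := g.2
  rw [Matrix.mem_specialUnitaryGroup_iff, Matrix.mem_unitaryGroup_iff] at h
  obtain ⟨hu, -⟩ := h
  have hu' : star g.1 * g.1 = 1 := mul_eq_one_comm.mp hu
  set M := g.1 * sigmaDot v * star g.1 with hM
  have hs : star (sigmaDot v) = sigmaDot v := by
    ext i j
    fin_cases i <;> fin_cases j <;>
      simp [sigmaDot, pauli, Fin.sum_univ_three, Matrix.star_apply]
  have hstar : star M = M := by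
    rw [hM, star_mul, star_mul, star_star, hs, mul_assoc]
  have htr : M.trace = 0 := by
    rw [hM, Matrix.trace_mul_comm, ← mul_assoc, hu', one_mul]
    simp [sigmaDot, pauli, Fin.sum_univ_three, Matrix.trace_fin_two]
  have e00 := congrFun (congrFun hstar 0) 0
  have e01 := congrFun (congrFun hstar 0) 1
  have e11 := congrFun (congrFun hstar 1) 1
  rw [Matrix.trace_fin_two] at htr
  simp only [Matrix.star_apply, Complex.ext_iff, Complex.star_def, Complex.conj_re,
    Complex.conj_im, Complex.add_re, Complex.add_im, Complex.zero_re, Complex.zero_im]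
    at e00 e01 e11 htr
  have hc : cover g v = WithLp.toLp 2 fun a => (1 / 2 : ℝ) * (Matrix.trace (pauli a * M)).re := rfl
  rw [hc]
  ext i j
  fin_cases i <;> fin_cases j <;> apply Complex.ext <;>
    simp [sigmaDot, pauli, Fin.sum_univ_three, Matrix.trace_fin_two, Matrix.mul_apply] <;>
    linarith [e00.1, e00.2, e01.1, e01.2, e11.1, e11.2, htr.1, htr.2]

/-- A skew product over the domain `U` of phase space: a smooth Hamiltonian `A`, a smooth field
`B`, the (complete) Hamiltonian flow `φ` of `A` on `U`, and the `SU(2)`-valued spin transporter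
`g`, the solution of `ġ + (i/2) σ·B(φ^t(z)) g = 0`, `g(z, 0) = 1`. On `U` the flow and the spin
transporter are uniquely determined by `A` and `B`. -/
structure SkewProduct (d : ℕ) (U : Set (Phase d)) where
  A : Phase d → ℝ
  B : Phase d → Spin
  φ : ℝ → Phase d → Phase d
  g : Phase d → ℝ → SU2
  smooth_A : ContDiffOn ℝ ∞ A U
  smooth_B : ContDiffOn ℝ ∞ B U
  flow_mem : ∀ z ∈ U, ∀ t, φ t z ∈ U
  flow_zero : ∀ z ∈ U, φ 0 z = z
  hamilton : ∀ z ∈ U, ∀ t,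
    HasDerivAt (fun τ => φ τ z) (hamiltonianVectorField A (φ t z)) t
  transport_zero : ∀ z ∈ U, g z 0 = 1
  transport : ∀ z ∈ U, ∀ t, ∀ a b : Fin 2,
    HasDerivAt (fun τ => (g z τ).1 a b)
      (-((Complex.I / 2) • (sigmaDot (B (φ t z)) * (g z t).1)) a b) t

/-- The classical skew product flow `(p, x, s) ↦ (φ^t(p, x), R s)`, where the rotation
`R` is the image of the spin transporter `g(p, x, t)` under the covering map. -/
noncomputable def SkewProduct.flow {d : ℕ} {U : Set (Phase d)} (Y : SkewProduct d U) (t : ℝ)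
    (q : Phase d × Spin) : Phase d × Spin :=
  (Y.φ t q.1, cover (Y.g q.1 t) q.2)

/-- The component `({A_j, B_k} + {B_j, A_k} - B_j × B_k)_a`, `a = 1, 2, 3`, where
the Poisson bracket is extended to vector-valued functions componentwise. -/
noncomputable def spinBracket {d : ℕ} {U : Set (Phase d)} (Y Y' : SkewProduct d U)
    (z : Phase d) (a : Fin 3) : ℝ :=
  poisson Y.A (fun w => Y'.B w a) z + poisson (fun w => Y.B w a) Y'.A z
    - crossProduct (Y.B z).ofLp (Y'.B z).ofLp a

/-- The skew products `Z_1, …, Z_d` show that `Y` is integrable: `Z_1 = Y`, the Hamiltonians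
`A_1, …, A_d` are pairwise in involution, and so are the fields, in the sense that
`{A_j, B_k} + {B_j, A_k} - B_j × B_k = 0`. The independence of `A_1, …, A_d` is required on
the Liouville–Arnold tori, see `IsLiouvilleArnoldTorus`. -/
structure IsIntegrableBy {d : ℕ} [NeZero d] {U : Set (Phase d)} (Y : SkewProduct d U)
    (Z : Fin d → SkewProduct d U) : Prop where
  base : Z 0 = Y
  involution : ∀ j k, ∀ z ∈ U, poisson (Z j).A (Z k).A z = 0
  spin_involution : ∀ j k, ∀ z ∈ U, ∀ a, spinBracket (Z j) (Z k) z a = 0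

/-- A Liouville–Arnold torus: a compact connected component of a common level set of
`A_1, …, A_d` in `U` at all of whose points the differentials `dA_1, …, dA_d` are linearly
independent. In particular every nonempty compact connected regular level set is one. -/
def IsLiouvilleArnoldTorus {d : ℕ} {U : Set (Phase d)} (Z : Fin d → SkewProduct d U)
    (T : Set (Phase d)) : Prop :=
  (∃ z ∈ U, T = connectedComponentIn {w ∈ U | ∀ j, (Z j).A w = (Z j).A z} z) ∧
  IsCompact T ∧
  ∀ w ∈ T, LinearIndependent ℝ fun j => fderiv ℝ (Z j).A w

/-- `T` is a smoothly embedded `d`-torus: there are angular coordinates modulo `2π` on `T` given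
by an immersion `ℝ^d → ℝ^d × ℝ^d` with image `T` that induces a bijection
`(ℝ / 2πℤ)^d → T`. -/
def IsEmbeddedTorus {d : ℕ} (T : Set (Phase d)) : Prop :=
  ∃ Θ : (Fin d → ℝ) → Phase d, ContDiff ℝ ∞ Θ ∧
    (∀ u, Function.Injective (fderiv ℝ Θ u)) ∧
    (∀ u v, Θ u = Θ v ↔ ∀ i, ∃ k : ℤ, v i = u i + 2 * Real.pi * k) ∧
    Set.range Θ = T

/-- `n` is smooth along `T`: locally on `T` it is the restriction of a smooth map on an open
subset of phase space. -/
def IsSmoothAlong {d : ℕ} (T : Set (Phase d)) (n : Phase d → Spin) : Prop :=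
  ∀ z ∈ T, ∃ V : Set (Phase d), IsOpen V ∧ z ∈ V ∧
    ∃ m : Phase d → Spin, ContDiffOn ℝ ∞ m V ∧ ∀ w ∈ T ∩ V, n w = m w

/-- The set `𝒯_θ = {(p, x, s) ∈ T × S² | ∠(s, n(p, x)) = θ}`. -/
def latitudeBundle {d : ℕ} (n : Phase d → Spin) (T : Set (Phase d)) (θ : ℝ) :
    Set (Phase d × Spin) :=
  {q | q.1 ∈ T ∧ q.2 ∈ spinSphere ∧ InnerProductGeometry.angle q.2 (n q.1) = θ}

/-- `E`, with the projection `(z, s) ↦ z`, is a smooth fibre bundle over `T` with typical fibre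
`S¹ = {w ∈ ℂ | |w| = 1}`, embedded in `T × S²`: over a neighbourhood in `T` of each point there
is a fibre preserving bijection `(z, w) ↦ (z, F (z, w))` from the product with `S¹` onto the part
of `E` there, with inverse `(z, s) ↦ (z, G (z, s))`, where `F` and `G` are smooth. -/
def IsSmoothCircleBundle {d : ℕ} (T : Set (Phase d)) (E : Set (Phase d × Spin)) : Prop :=
  E ⊆ T ×ˢ spinSphere ∧
  ∀ z₀ ∈ T, ∃ V : Set (Phase d), IsOpen V ∧ z₀ ∈ V ∧
    ∃ (F : Phase d × ℂ → Spin) (G : Phase d × Spin → ℂ),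
      ContDiffOn ℝ ∞ F (V ×ˢ Set.univ) ∧ ContDiffOn ℝ ∞ G (V ×ˢ Set.univ) ∧
      (∀ z ∈ T ∩ V, ∀ w : ℂ, ‖w‖ = 1 → (z, F (z, w)) ∈ E ∧ G (z, F (z, w)) = w) ∧
      (∀ z ∈ T ∩ V, ∀ s : Spin, (z, s) ∈ E → ‖G (z, s)‖ = 1 ∧ F (z, G (z, s)) = s)

end SpinPrecession

/-!
By the integrability conditions the Hamiltonian vector fields `X_j` of `A_j`, lifted to `U × SU(2)`
by `(z, g) ↦ (X_j z, -(i/2) σ·B_j(z) g)`, commute (`fderiv_lift_comm`). Hence the lifted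
flows commute (`IsFlowOn.commute`) and combine to an action of `ℝ^d` on `U × SU(2)`
(`exists_isMultiFlowOn`). It commutes with right multiplication, so it consists of an action `Φ` on
`U` and a cocycle `D` with values in `SU(2)` (`exists_isSpinAction`).

By conservation of the `A_j`, every Liouville–Arnold torus `T` is invariant under `Φ`, and by their
independence the orbits on `T` are relatively open
(`IsMultiFlowOn.exists_local_time`); so `T` is a single orbit. The periods of a point `z` of `T`
form a discrete subgroup of `ℝ^d`, which spans `ℝ^d` because `T` is compact. A lattice basis
gives angular coordinates (`IsLiouvilleArnoldTorus.isEmbeddedTorus`).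

For periods `λ` of `z` the map `λ ↦ D z λ` is a homomorphism into `SU(2)`. Its image is commutative,
so the rotations that it covers have a common axis `n z` (`exists_common_axis`). That the cocycle
takes values in `SU(2)`, and not just in `SO(3)`, is essential here. Transport of `n z` by the
action is well defined and gives the field `n`, with `n (Φ t z) = cover (D z t) (n z)`
(`IsLiouvilleArnoldTorus.exists_isAxisField`). Everything else follows from this equation: the flows
preserve the angle to `n`, and as a point `w` of `T` near `z` is `Φ (τ w) z` with `τ` smooth, both
the smoothness of `n` and local trivializations of the circle bundles come from the smooth rotations
`cover (D z (τ w))`.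

Smooth dependence of flows on initial conditions is never needed: commutation of flows uses only a
Grönwall estimate for the derivative along the other field, and the action is smooth in
time for a fixed starting point because its time derivatives are smooth functions of the position.
-/

namespace SpinPrecession

open Set Filter Topology Metric
open scoped NNReal

/-! ### Complete flows -/

section Flows

variable {E : Type*} [NormedAddCommGroup E] [NormedSpace ℝ E]

/-- `φ` is the complete flow on `W` of the vector field `X`. Nothing is required off `W`. -/
structure IsFlowOn (X : E → E) (W : Set E) (φ : ℝ → E → E) : Prop where
  mem : ∀ z ∈ W, ∀ t, φ t z ∈ W
  zero : ∀ z ∈ W, φ 0 z = z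
  hasDerivAt : ∀ z ∈ W, ∀ t, HasDerivAt (fun τ => φ τ z) (X (φ t z)) t

theorem IsFlowOn.neg {X : E → E} {W : Set E} {φ : ℝ → E → E} (h : IsFlowOn X W φ) :
    IsFlowOn (fun z => -X z) W fun t z => φ (-t) z where
  mem z hz t := h.mem z hz (-t)
  zero z hz := by simpa using h.zero z hz
  hasDerivAt z hz t := by
    simpa [Function.comp_def] using (h.hasDerivAt z hz (-t)).scomp t (hasDerivAt_neg t)

theorem IsFlowOn.continuous {X : E → E} {W : Set E} {φ : ℝ → E → E} (h : IsFlowOn X W φ) {z : E}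
    (hz : z ∈ W) : Continuous fun t => φ t z :=
  continuous_iff_continuousAt.2 fun t => (h.hasDerivAt z hz t).continuousAt

/-- On a uniform neighbourhood of a compact set a `C¹` field is Lipschitz with a uniform constant.
The bound `1 ≤ K` keeps the division by `K` in Grönwall's inequality harmless. -/
theorem exists_lipschitz_tube {X : E → E} {W : Set E} (hW : IsOpen W) (hX : ContDiffOn ℝ 1 X W)
    {C : Set E} (hC : IsCompact C) (hCW : C ⊆ W) :
    ∃ r > 0, ∃ K : ℝ≥0, 1 ≤ K ∧ ∀ z ∈ C, closedBall z r ⊆ W ∧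
      LipschitzOnWith K X (closedBall z r) := by
  obtain ⟨r₁, hr₁, hsub⟩ := hC.exists_cthickening_subset_open hW hCW
  have hcont : ContinuousOn (fderiv ℝ X) W := hX.continuousOn_fderiv_of_isOpen hW le_rfl
  obtain ⟨M, hM⟩ := hC.exists_bound_of_continuousOn (hcont.mono hCW)
  have hunif := hC.uniformContinuousAt_of_continuousAt (fderiv ℝ X)
    (fun a ha => hcont.continuousAt (hW.mem_nhds (hCW ha))) (dist_mem_uniformity one_pos)
  obtain ⟨r₂, hr₂, hr₂'⟩ := mem_uniformity_dist.1 hunif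
  refine ⟨min r₁ (r₂ / 2), by positivity, Real.toNNReal M + 1, by simp, fun z hz => ?_⟩
  have hball : closedBall z (min r₁ (r₂ / 2)) ⊆ W := fun y hy =>
    hsub (mem_cthickening_of_dist_le y z r₁ C hz ((mem_closedBall.1 hy).trans (min_le_left _ _)))
  refine ⟨hball, (convex_closedBall _ _).lipschitzOnWith_of_nnnorm_fderiv_le
    (fun y hy => (hX.differentiableOn one_ne_zero).differentiableAt (hW.mem_nhds (hball hy)))
    fun y hy => ?_⟩
  have h1 : dist (fderiv ℝ X z) (fderiv ℝ X y) < 1 := by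
    refine hr₂' ?_ hz
    rw [dist_comm]
    exact ((mem_closedBall.1 hy).trans (min_le_right _ _)).trans_lt (by linarith)
  rw [← NNReal.coe_le_coe]
  have h2 := hM z hz
  rw [dist_comm, dist_eq_norm] at h1
  have h3 := norm_le_norm_add_norm_sub' (fderiv ℝ X y) (fderiv ℝ X z)
  have h4 := Real.le_coe_toNNReal M
  simp only [coe_nnnorm, NNReal.coe_add, NNReal.coe_one]
  linarith

/-- Lipschitz dependence on the initial condition. The second trajectory is not assumed to stay
near the first: by Grönwall's inequality it cannot leave the tube on which the field is Lipschitz. -/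
theorem exists_dist_le_of_trajectories {X : E → E} {W : Set E} (hW : IsOpen W)
    (hX : ContDiffOn ℝ 1 X W) {γ : ℝ → E} (hγ : ∀ t, HasDerivAt γ (X (γ t)) t)
    (hγW : ∀ t, γ t ∈ W) (T : ℝ) :
    ∃ δ > 0, ∃ C > 0, ∀ α : ℝ → E, (∀ t, HasDerivAt α (X (α t)) t) → dist (α 0) (γ 0) < δ →
      ∀ t ∈ Icc 0 T, dist (α t) (γ t) ≤ C * dist (α 0) (γ 0) := by
  have hγc : Continuous γ := continuous_iff_continuousAt.2 fun t => (hγ t).continuousAt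
  obtain ⟨r, hr, K, -, htube⟩ := exists_lipschitz_tube hW hX
    ((isCompact_Icc (a := (0 : ℝ)) (b := T)).image hγc) (by rintro _ ⟨t, -, rfl⟩; exact hγW t)
  refine ⟨r / Real.exp (K * T), by positivity, Real.exp (K * T), by positivity,
    fun α hα hd t ht => ?_⟩
  have hαc : Continuous α := continuous_iff_continuousAt.2 fun t => (hα t).continuousAt
  have hgron : ∀ u ∈ Icc 0 T, (∀ τ ∈ Icc 0 u, dist (α τ) (γ τ) ≤ r) →
      dist (α u) (γ u) ≤ dist (α 0) (γ 0) * Real.exp (K * u) := by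
    intro u hu hstay
    have := dist_le_of_trajectories_ODE_of_mem (v := fun _ => X) (K := K) (a := 0) (b := u)
      (s := fun τ => closedBall (γ τ) r)
      (fun τ hτ => (htube _ ⟨τ, ⟨hτ.1, hτ.2.le.trans hu.2⟩, rfl⟩).2)
      hαc.continuousOn (fun τ _ => (hα τ).hasDerivWithinAt)
      (fun τ hτ => mem_closedBall.2 (hstay τ ⟨hτ.1, hτ.2.le⟩))
      hγc.continuousOn (fun τ _ => (hγ τ).hasDerivWithinAt)
      (fun τ _ => mem_closedBall_self hr.le) le_rfl u ⟨hu.1, le_rfl⟩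
    simpa using this
  have hexp : ∀ u ∈ Icc 0 T, Real.exp (K * u) ≤ Real.exp (K * T) := fun u hu =>
    Real.exp_le_exp.2 (mul_le_mul_of_nonneg_left hu.2 K.2)
  have hd' : dist (α 0) (γ 0) * Real.exp (K * T) < r := (lt_div_iff₀ (by positivity)).1 hd
  have hlt : ∀ u ∈ Icc 0 T, (∀ τ ∈ Icc 0 u, dist (α τ) (γ τ) ≤ r) → dist (α u) (γ u) < r :=
    fun u hu h => (hgron u hu h).trans_lt
      ((mul_le_mul_of_nonneg_left (hexp u hu) dist_nonneg).trans_lt hd')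
  have hstay : Icc 0 T ⊆ {τ | dist (α τ) (γ τ) ≤ r} := by
    apply IsClosed.Icc_subset_of_forall_mem_nhdsGT_of_Icc_subset
    · exact (isClosed_le (hαc.dist hγc) continuous_const).inter isClosed_Icc
    · have : 0 ≤ T := ht.1.trans ht.2
      exact (hlt 0 ⟨le_rfl, this⟩ (fun τ hτ => by
        obtain rfl : τ = 0 := le_antisymm hτ.2 hτ.1
        exact hd.le.trans (div_le_self hr.le (Real.one_le_exp (mul_nonneg K.2 this))))).le
    · intro u hu hsub
      refine mem_nhdsWithin_of_mem_nhds ?_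
      filter_upwards [(hαc.dist hγc).continuousAt.eventually_lt continuousAt_const
        (hlt u ⟨hu.1, hu.2.le⟩ hsub)] with τ hτ using le_of_lt hτ
  calc dist (α t) (γ t) ≤ dist (α 0) (γ 0) * Real.exp (K * t) :=
        hgron t ht fun τ hτ => hstay ⟨hτ.1, hτ.2.trans ht.2⟩
    _ ≤ Real.exp (K * T) * dist (α 0) (γ 0) := by
        rw [mul_comm]; exact mul_le_mul_of_nonneg_right (hexp t ht) dist_nonneg

theorem exists_dist_le_of_trajectories_Icc_neg {X : E → E} {W : Set E} (hW : IsOpen W)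
    (hX : ContDiffOn ℝ 1 X W) {γ : ℝ → E} (hγ : ∀ t, HasDerivAt γ (X (γ t)) t)
    (hγW : ∀ t, γ t ∈ W) (T : ℝ) :
    ∃ δ > 0, ∃ C > 0, ∀ α : ℝ → E, (∀ t, HasDerivAt α (X (α t)) t) → dist (α 0) (γ 0) < δ →
      ∀ t ∈ Icc (-T) T, dist (α t) (γ t) ≤ C * dist (α 0) (γ 0) := by
  have hrev : ∀ α : ℝ → E, (∀ t, HasDerivAt α (X (α t)) t) →
      ∀ t, HasDerivAt (fun τ => α (-τ)) (-X (α (-t))) t := fun α hα t => by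
    simpa [Function.comp_def] using (hα (-t)).scomp t (hasDerivAt_neg t)
  obtain ⟨δ₁, hδ₁, C₁, hC₁, h₁⟩ := exists_dist_le_of_trajectories hW hX hγ hγW T
  obtain ⟨δ₂, hδ₂, C₂, hC₂, h₂⟩ := exists_dist_le_of_trajectories (X := fun z => -X z) hW
    hX.neg (hrev γ hγ) (fun t => hγW (-t)) T
  refine ⟨min δ₁ δ₂, by positivity, max C₁ C₂, by positivity, fun α hα hd t ht => ?_⟩
  rcases le_total 0 t with h0 | h0
  · exact (h₁ α hα (hd.trans_le (min_le_left _ _)) t ⟨h0, ht.2⟩).trans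
      (mul_le_mul_of_nonneg_right (le_max_left _ _) dist_nonneg)
  · have := h₂ _ (hrev α hα) (by simpa using hd.trans_le (min_le_right _ _)) (-t)
      ⟨by linarith, by linarith [ht.1]⟩
    simp only [neg_neg, neg_zero] at this
    exact this.trans (mul_le_mul_of_nonneg_right (le_max_right _ _) dist_nonneg)

theorem trajectory_unique {X : E → E} {W : Set E} (hW : IsOpen W)
    (hX : ContDiffOn ℝ 1 X W) {α γ : ℝ → E} (hγ : ∀ t, HasDerivAt γ (X (γ t)) t)
    (hγW : ∀ t, γ t ∈ W) (hα : ∀ t, HasDerivAt α (X (α t)) t) (h0 : α 0 = γ 0) : α = γ := by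
  funext t
  obtain ⟨δ, hδ, C, hC, h⟩ := exists_dist_le_of_trajectories_Icc_neg hW hX hγ hγW |t|
  have := h α hα (by simpa [h0] using hδ) t ⟨neg_abs_le t, le_abs_self t⟩
  rw [h0, dist_self, mul_zero] at this
  exact dist_le_zero.1 this

variable {X : E → E} {W : Set E} {φ : ℝ → E → E}

theorem IsFlowOn.add_apply (h : IsFlowOn X W φ) (hW : IsOpen W) (hX : ContDiffOn ℝ 1 X W)
    (s t : ℝ) {z : E} (hz : z ∈ W) : φ (s + t) z = φ s (φ t z) := by
  have hm := h.mem z hz t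
  refine congrFun (trajectory_unique hW hX (α := fun s => φ (s + t) z) (h.hasDerivAt _ hm)
    (h.mem _ hm) (fun s => ?_) ?_) s
  · exact (h.hasDerivAt z hz (s + t)).comp_add_const s t
  · simp [h.zero _ hm]

theorem IsFlowOn.continuousAt (h : IsFlowOn X W φ) (hW : IsOpen W) (hX : ContDiffOn ℝ 1 X W)
    (t : ℝ) {z : E} (hz : z ∈ W) : ContinuousAt (fun p : ℝ × E => φ p.1 p.2) (t, z) := by
  obtain ⟨δ, hδ, C, hC, hd⟩ := exists_dist_le_of_trajectories_Icc_neg hW hX (h.hasDerivAt z hz)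
    (h.mem z hz) (|t| + 1)
  rw [ContinuousAt, tendsto_iff_dist_tendsto_zero]
  have hlim : Tendsto (fun p : ℝ × E => C * dist p.2 z + dist (φ p.1 z) (φ t z)) (𝓝 (t, z))
      (𝓝 0) := by
    have hc : Continuous fun p : ℝ × E => C * dist p.2 z + dist (φ p.1 z) (φ t z) := by
      have := h.continuous hz
      fun_prop
    simpa using hc.tendsto (t, z)
  refine squeeze_zero' (Eventually.of_forall fun _ => dist_nonneg) ?_ hlim
  have e1 : ∀ᶠ p : ℝ × E in 𝓝 (t, z), p.2 ∈ W ∧ dist p.2 z < δ :=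
    (continuousAt_snd : Tendsto Prod.snd (𝓝 (t, z)) (𝓝 z)).eventually
      ((hW.eventually_mem hz).and (ball_mem_nhds z hδ))
  have e2 : ∀ᶠ p : ℝ × E in 𝓝 (t, z), dist p.1 t < 1 :=
    (continuousAt_fst : Tendsto Prod.fst (𝓝 (t, z)) (𝓝 t)).eventually (ball_mem_nhds t one_pos)
  filter_upwards [e1, e2] with p hp1 hp2
  refine (dist_triangle _ (φ p.1 z) _).trans (add_le_add ?_ le_rfl)
  have hp : p.1 ∈ Icc (-(|t| + 1)) (|t| + 1) := by
    rw [Real.dist_eq] at hp2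
    rw [mem_Icc, ← abs_le]
    have := abs_sub_abs_le_abs_sub p.1 t
    linarith
  simpa [h.zero _ hp1.1, h.zero _ hz] using hd _ (h.hasDerivAt _ hp1.1)
    (by simpa [h.zero _ hp1.1, h.zero _ hz] using hp1.2) p.1 hp

end Flows

/-! ### Commuting flows -/

section Commuting

variable {E : Type*} [NormedAddCommGroup E] [NormedSpace ℝ E]
  {X V : E → E} {W : Set E} {φ ψ : ℝ → E → E}

theorem gronwallBound_le {δ K ε x T : ℝ} (hδ : 0 ≤ δ) (hε : 0 ≤ ε) (hK : 1 ≤ K)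
    (hx : x ≤ T) : gronwallBound δ K ε x ≤ (δ + ε) * Real.exp (K * T) := by
  have hK0 : K ≠ 0 := by positivity
  rw [gronwallBound_of_K_ne_0 hK0]
  have h1 : Real.exp (K * x) ≤ Real.exp (K * T) :=
    Real.exp_le_exp.2 (mul_le_mul_of_nonneg_left hx (by linarith))
  have h2 : ε / K ≤ ε := div_le_self hε hK
  have h3 : 0 ≤ ε / K := by positivity
  have h4 := Real.exp_pos (K * T)
  nlinarith [mul_le_mul_of_nonneg_left h1 hδ, mul_le_mul_of_nonneg_left h1 h3,
    mul_le_mul_of_nonneg_right h2 h4.le]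

/-- A `C¹` field is differentiable uniformly on compact sets, with increments that may leave the
compact set. -/
theorem exists_uniform_linearization (hW : IsOpen W) (hX : ContDiffOn ℝ 1 X W) {C : Set E}
    (hC : IsCompact C) (hCW : C ⊆ W) {ε : ℝ} (hε : 0 < ε) :
    ∃ r > 0, ∀ z ∈ C, ∀ u : E, ‖u‖ < r → ‖X (z + u) - X z - fderiv ℝ X z u‖ ≤ ε * ‖u‖ := by
  obtain ⟨r₁, hr₁, _, _, hsub⟩ := exists_lipschitz_tube hW hX hC hCW
  have hcont : ContinuousOn (fderiv ℝ X) W := hX.continuousOn_fderiv_of_isOpen hW le_rfl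
  have hunif := hC.uniformContinuousAt_of_continuousAt (fderiv ℝ X)
    (fun a ha => hcont.continuousAt (hW.mem_nhds (hCW ha))) (dist_mem_uniformity hε)
  obtain ⟨r₂, hr₂, hr₂'⟩ := mem_uniformity_dist.1 hunif
  refine ⟨min r₁ r₂, lt_min hr₁ hr₂, fun z hz u hu => ?_⟩
  have := (convex_ball z (min r₁ r₂)).norm_image_sub_le_of_norm_fderiv_le' (𝕜 := ℝ) (f := X)
    (φ := fderiv ℝ X z) (C := ε) (x := z) (y := z + u)
    (fun y hy => (hX.differentiableOn one_ne_zero).differentiableAt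
      (hW.mem_nhds ((hsub z hz).1 (ball_subset_closedBall
        (ball_subset_ball (min_le_left _ _) hy)))))
    (fun y hy => ?_) (mem_ball_self (lt_min hr₁ hr₂)) (by simpa using hu)
  · simpa using this
  · rw [← dist_eq_norm, dist_comm]
    refine (hr₂' ?_ hz).le
    rw [dist_comm]
    exact (mem_ball.1 hy).trans_le (min_le_right _ _)

theorem IsFlowOn.hasDerivAt_comp_of_nonneg (h : IsFlowOn X W φ) (hW : IsOpen W)
    (hX : ContDiffOn ℝ 1 X W) (hV : ContDiffOn ℝ 1 V W)
    (hXV : ∀ w ∈ W, fderiv ℝ X w (V w) = fderiv ℝ V w (X w)) {z : E} (hz : z ∈ W) {c : ℝ → E}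
    (hc0 : c 0 = z) (hc : HasDerivAt c (V z) 0) {t : ℝ} (ht : 0 ≤ t) :
    HasDerivAt (fun η => φ t (c η)) (V (φ t z)) 0 := by
  set γ : ℝ → E := fun τ => φ τ z with hγ
  have hγc : Continuous γ := h.continuous hz
  have hγW : ∀ τ, γ τ ∈ W := h.mem z hz
  have hVd : ∀ τ, HasDerivAt (fun τ => V (γ τ)) (fderiv ℝ X (γ τ) (V (γ τ))) τ := fun τ => by
    rw [hXV _ (hγW τ)]
    exact ((hV.differentiableOn one_ne_zero).differentiableAt
      (hW.mem_nhds (hγW τ))).hasFDerivAt.comp_hasDerivAt τ (h.hasDerivAt z hz τ)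
  have hVc : Continuous fun τ => V (γ τ) :=
    continuous_iff_continuousAt.2 fun τ => (hVd τ).continuousAt
  have hcpt : IsCompact (γ '' Icc 0 t) := isCompact_Icc.image hγc
  have hsub : γ '' Icc 0 t ⊆ W := by rintro _ ⟨τ, -, rfl⟩; exact hγW τ
  obtain ⟨r, hr, K, hK, htube⟩ := exists_lipschitz_tube hW hX hcpt hsub
  obtain ⟨δ, hδ, C, hC, hdep⟩ := exists_dist_le_of_trajectories hW hX (h.hasDerivAt z hz) hγW t
  obtain ⟨M, hM⟩ := (isCompact_Icc (a := (0 : ℝ)) (b := t)).exists_bound_of_continuousOn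
    hVc.continuousOn
  have hM0 : 0 ≤ M := (norm_nonneg _).trans (hM 0 ⟨le_rfl, ht⟩)
  rw [hasDerivAt_iff_isLittleO, Asymptotics.isLittleO_iff]
  intro ε hε
  set ε' := ε / (2 * Real.exp (K * t)) with hε'
  have hε'0 : 0 < ε' := by positivity
  obtain ⟨ρ, hρ, hlin⟩ := exists_uniform_linearization hW hX hcpt hsub
    (ε := ε' / (M + 1)) (by positivity)
  have e1 : ∀ᶠ η in 𝓝 (0 : ℝ), ‖c η - c 0 - (η - 0) • V z‖ ≤ ε' * ‖η - 0‖ :=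
    Asymptotics.isLittleO_iff.1 (hasDerivAt_iff_isLittleO.1 hc) hε'0
  have e2 : ∀ᶠ η in 𝓝 (0 : ℝ), c η ∈ W ∧ dist (c η) z < min δ (r / C) := by
    have hcc : Tendsto c (𝓝 0) (𝓝 z) := hc0 ▸ hc.continuousAt
    exact hcc.eventually ((hW.eventually_mem hz).and (ball_mem_nhds z (by positivity)))
  have e3 : ∀ᶠ η in 𝓝 (0 : ℝ), |η| * (M + 1) < min r ρ := by
    have : Tendsto (fun η : ℝ => |η| * (M + 1)) (𝓝 0) (𝓝 0) := by
      have : Continuous fun η : ℝ => |η| * (M + 1) := by fun_prop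
      simpa using this.tendsto 0
    exact this.eventually (Iio_mem_nhds (by positivity))
  filter_upwards [e1, e2, e3] with η he1 he2 he3
  simp only [sub_zero, hc0] at he1 ⊢
  have hsmall : ∀ τ ∈ Icc 0 t, ‖η • V (γ τ)‖ ≤ |η| * M := fun τ hτ => by
    rw [norm_smul, Real.norm_eq_abs]
    exact mul_le_mul_of_nonneg_left (hM τ hτ) (abs_nonneg _)
  have hηM : |η| * M ≤ |η| * (M + 1) := mul_le_mul_of_nonneg_left (by linarith) (abs_nonneg _)
  have hmem : ∀ τ ∈ Icc 0 t, γ τ ∈ γ '' Icc 0 t := fun τ hτ => ⟨τ, hτ, rfl⟩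
  -- The curve `τ ↦ γ τ + η • V (γ τ)` solves the equation of `X` up to an error `o(η)`, because
  -- `V ∘ γ` solves the linearized equation.
  have hgron := dist_le_of_approx_trajectories_ODE_of_mem (v := fun _ => X) (K := K) (a := 0)
    (b := t) (s := fun τ => closedBall (γ τ) r) (f := fun τ => φ τ (c η))
    (f' := fun τ => X (φ τ (c η))) (g := fun τ => γ τ + η • V (γ τ))
    (g' := fun τ => X (γ τ) + η • fderiv ℝ X (γ τ) (V (γ τ)))
    (εf := 0) (εg := ε' * |η|) (δ := ε' * |η|)
    (fun τ hτ => (htube _ (hmem τ ⟨hτ.1, hτ.2.le⟩)).2)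
    (h.continuous he2.1).continuousOn
    (fun τ _ => (h.hasDerivAt _ he2.1 τ).hasDerivWithinAt)
    (fun τ _ => by simp)
    (fun τ hτ => by
      have h1 := hdep (fun τ => φ τ (c η)) (h.hasDerivAt _ he2.1)
        (by simpa [h.zero _ he2.1, h.zero z hz] using he2.2.trans_le (min_le_left _ _)) τ
        ⟨hτ.1, hτ.2.le⟩
      rw [h.zero _ he2.1, h.zero z hz] at h1
      have h2 := he2.2.trans_le (min_le_right δ (r / C))
      rw [lt_div_iff₀ hC] at h2
      rw [mem_closedBall]
      refine h1.trans ?_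
      rw [mul_comm]; exact h2.le)
    (hγc.add (hVc.const_smul η)).continuousOn
    (fun τ _ => ((h.hasDerivAt z hz τ).add ((hVd τ).const_smul η)).hasDerivWithinAt)
    (fun τ hτ => by
      have hτ' : τ ∈ Icc 0 t := ⟨hτ.1, hτ.2.le⟩
      have h1 := hlin _ (hmem τ hτ') (η • V (γ τ))
        ((hsmall τ hτ').trans_lt (hηM.trans_lt (he3.trans_le (min_le_right _ _))))
      rw [dist_comm, dist_eq_norm, ← sub_sub]
      rw [map_smul] at h1
      refine h1.trans ?_
      rw [div_mul_eq_mul_div, div_le_iff₀ (by positivity), mul_assoc]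
      exact mul_le_mul_of_nonneg_left ((hsmall τ hτ').trans hηM) hε'0.le)
    (fun τ hτ => by
      rw [mem_closedBall, dist_eq_norm, add_sub_cancel_left]
      exact (hsmall τ ⟨hτ.1, hτ.2.le⟩).trans
        (hηM.trans (he3.trans_le (min_le_left _ _)).le))
    (by
      rw [h.zero _ he2.1, hγ]
      simp only [h.zero z hz]
      rw [dist_eq_norm, ← sub_sub]
      simpa using he1)
    t ⟨ht, le_rfl⟩
  have hb := gronwallBound_le (δ := ε' * |η|) (K := K) (ε := 0 + ε' * |η|) (x := t - 0) (T := t)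
    (by positivity) (by positivity) (by exact_mod_cast hK) (by simp)
  rw [sub_sub, ← dist_eq_norm]
  refine (hgron.trans hb).trans (le_of_eq ?_)
  rw [hε', Real.norm_eq_abs]
  field_simp
  ring

/-- The flow of `X` maps curves tangent to `V` to curves tangent to `V` if `X` and `V` commute.
This replaces differentiability of the flow in the initial condition, of which only the derivative
along `V` is needed. -/
theorem IsFlowOn.hasDerivAt_comp (h : IsFlowOn X W φ) (hW : IsOpen W)
    (hX : ContDiffOn ℝ 1 X W) (hV : ContDiffOn ℝ 1 V W)
    (hXV : ∀ w ∈ W, fderiv ℝ X w (V w) = fderiv ℝ V w (X w)) {z : E} (hz : z ∈ W) {c : ℝ → E}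
    (hc0 : c 0 = z) (hc : HasDerivAt c (V z) 0) (t : ℝ) :
    HasDerivAt (fun η => φ t (c η)) (V (φ t z)) 0 := by
  rcases le_total 0 t with ht | ht
  · exact h.hasDerivAt_comp_of_nonneg hW hX hV hXV hz hc0 hc ht
  · simpa using h.neg.hasDerivAt_comp_of_nonneg hW hX.neg hV
      (fun w hw => by simp [fderiv_fun_neg, hXV w hw]) hz hc0 hc (neg_nonneg.2 ht)

/-- For commuting fields, `s ↦ φ t (ψ s z)` is an integral curve of `V`, hence equal to
`s ↦ ψ s (φ t z)`. -/
theorem IsFlowOn.commute (h : IsFlowOn X W φ) (h' : IsFlowOn V W ψ) (hW : IsOpen W)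
    (hX : ContDiffOn ℝ 1 X W) (hV : ContDiffOn ℝ 1 V W)
    (hXV : ∀ w ∈ W, fderiv ℝ X w (V w) = fderiv ℝ V w (X w)) (s t : ℝ) {z : E} (hz : z ∈ W) :
    φ t (ψ s z) = ψ s (φ t z) := by
  have hm := h.mem z hz t
  refine congrFun (trajectory_unique hW hV (α := fun s => φ t (ψ s z)) (h'.hasDerivAt _ hm)
    (h'.mem _ hm) (fun s => ?_) ?_) s
  · have := h.hasDerivAt_comp hW hX hV hXV (h'.mem z hz s) (c := fun η => ψ (η + s) z) (by simp)
      (by simpa using (h'.hasDerivAt z hz (0 + s)).comp_add_const 0 s) t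
    have h2 := HasDerivAt.comp_add_const s (-s) (by simpa using this)
    simpa using h2
  · simp [h'.zero z hz, h'.zero _ hm]

end Commuting

/-! ### Actions of `ℝ^ι` generated by commuting fields -/

section MultiFlow

variable {ι : Type*} [Fintype ι]
variable {E : Type*} [NormedAddCommGroup E] [NormedSpace ℝ E]

/-- `Φ` is an action of the additive group `ℝ^ι` on `W` with the vector fields `X j` as
infinitesimal generators. -/
structure IsMultiFlowOn (X : ι → E → E) (W : Set E) (Φ : (ι → ℝ) → E → E) : Prop where
  mem : ∀ z ∈ W, ∀ t, Φ t z ∈ W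
  zero : ∀ z ∈ W, Φ 0 z = z
  add : ∀ z ∈ W, ∀ s t, Φ (s + t) z = Φ s (Φ t z)
  hasFDerivAt : ∀ z ∈ W, ∀ t, HasFDerivAt (fun τ => Φ τ z)
    (∑ j, (ContinuousLinearMap.proj (R := ℝ) (φ := fun _ : ι => ℝ) j).smulRight (X j (Φ t z))) t

variable {X : ι → E → E} {W : Set E} {Φ : (ι → ℝ) → E → E}

/-- The time derivative is a smooth function of the position, so smoothness in time bootstraps. -/
theorem IsMultiFlowOn.contDiff (h : IsMultiFlowOn X W Φ) (hX : ∀ j, ContDiffOn ℝ ∞ (X j) W)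
    {z : E} (hz : z ∈ W) : ContDiff ℝ ∞ fun t => Φ t z := by
  rw [contDiff_infty]
  intro n
  induction n with
  | zero =>
    exact contDiff_zero.2 (continuous_iff_continuousAt.2 fun t =>
      (h.hasFDerivAt z hz t).continuousAt)
  | succ n ih =>
    push_cast
    rw [contDiff_succ_iff_fderiv]
    refine ⟨fun t => (h.hasFDerivAt z hz t).differentiableAt, by simp, ?_⟩
    rw [show fderiv ℝ (fun t => Φ t z) = fun t => ∑ j, (ContinuousLinearMap.proj (R := ℝ)
      (φ := fun _ : ι => ℝ) j).smulRight (X j (Φ t z)) from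
      funext fun t => (h.hasFDerivAt z hz t).fderiv]
    refine ContDiff.sum fun j _ => contDiff_const.smulRight ?_
    exact ((hX j).of_le (by exact_mod_cast le_top)).comp_contDiff ih fun t => h.mem z hz t

variable [DecidableEq ι]

/-- A function with partial derivatives `g j` everywhere is differentiable at the points where these
are continuous. -/
theorem hasFDerivAt_of_hasDerivAt_single {f : (ι → ℝ) → E} {g : ι → (ι → ℝ) → E} {t : ι → ℝ}
    (hg : ∀ j, ContinuousAt (g j) t)
    (hf : ∀ j u, HasDerivAt (fun η => f (u + Pi.single j η)) (g j u) 0) :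
    HasFDerivAt f (∑ j, (ContinuousLinearMap.proj (R := ℝ) (φ := fun _ : ι => ℝ) j).smulRight
      (g j t)) t := by
  have hf' : ∀ j (u : ι → ℝ) η, HasDerivAt (fun η => f (u + Pi.single j η))
      (g j (u + Pi.single j η : ι → ℝ)) η := by
    intro j u η
    have := HasDerivAt.comp_add_const η (-η) (by simpa using hf j (u + Pi.single j η : ι → ℝ))
    simpa [add_assoc, ← Pi.single_add] using this
  have key : ∀ s : Finset ι, (fun a : ι → ℝ => f (t + s.piecewise a 0) - f t -
      ∑ j ∈ s, a j • g j t) =o[𝓝 0] fun a => a := by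
    intro s
    induction s using Finset.induction_on with
    | empty => simp
    | insert i s hi ih =>
      have hstep : (fun a : ι → ℝ => f (t + (insert i s).piecewise a 0) - f (t + s.piecewise a 0) -
          a i • g i t) =o[𝓝 0] fun a => a := by
        rw [Asymptotics.isLittleO_iff]
        intro ε hε
        obtain ⟨δ, hδ, hδ'⟩ := Metric.continuousAt_iff.1 (hg i) ε hε
        filter_upwards [ball_mem_nhds (0 : ι → ℝ) hδ] with a ha
        rw [mem_ball_zero_iff] at ha
        have hins : (insert i s).piecewise a 0 = s.piecewise a 0 + Pi.single i (a i) := by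
          ext k
          by_cases hk : k = i
          · subst hk; simp [hi]
          · simp [Finset.piecewise, hk]
        have hmv := (convex_uIcc (0 : ℝ) (a i)).norm_image_sub_le_of_norm_hasDerivWithin_le
          (f := fun η => f (t + s.piecewise a 0 + Pi.single i η) - η • g i t)
          (f' := fun η => g i (t + s.piecewise a 0 + Pi.single i η) - (1 : ℝ) • g i t) (C := ε)
          (x := 0) (y := a i)
          (fun η _ => ((hf' i _ η).sub ((hasDerivAt_id η).smul_const _)).hasDerivWithinAt)
          (fun η hη => by
            rw [one_smul, ← dist_eq_norm]
            refine (hδ' ?_).le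
            rw [dist_eq_norm, add_assoc, add_sub_cancel_left]
            refine lt_of_le_of_lt ((pi_norm_le_iff_of_nonneg (norm_nonneg a)).2 fun k => ?_) ha
            by_cases hk : k = i
            · subst hk
              simp only [Pi.add_apply, Finset.piecewise_eq_of_notMem _ _ _ hi, Pi.zero_apply,
                Pi.single_eq_same, zero_add]
              refine le_trans ?_ (norm_le_pi_norm a k)
              have := abs_sub_left_of_mem_uIcc hη
              simpa using this
            · by_cases hks : k ∈ s
              · simpa [hk, hks] using norm_le_pi_norm a k
              · simp [hk, hks])
          left_mem_uIcc right_mem_uIcc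
        rw [hins, ← add_assoc]
        simp only [Pi.single_zero, add_zero, zero_smul, sub_zero] at hmv
        rw [sub_right_comm]
        exact hmv.trans (mul_le_mul_of_nonneg_left (norm_le_pi_norm a i) hε.le)
      refine (hstep.add ih).congr_left fun a => ?_
      rw [Finset.sum_insert hi]
      abel
  rw [hasFDerivAt_iff_isLittleO_nhds_zero]
  simpa using key Finset.univ

variable {φ : ι → ℝ → E → E}

/-- Complete flows of commuting fields combine to an action of `ℝ^ι`. -/
theorem exists_isMultiFlowOn (hW : IsOpen W) (hX : ∀ j, ContDiffOn ℝ 1 (X j) W)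
    (hφ : ∀ j, IsFlowOn (X j) W (φ j))
    (hbr : ∀ j k, ∀ w ∈ W, fderiv ℝ (X j) w (X k w) = fderiv ℝ (X k) w (X j w)) :
    ∃ Φ : (ι → ℝ) → E → E, IsMultiFlowOn X W Φ ∧
      ∀ z ∈ W, ∀ j t, Φ (Pi.single j t) z = φ j t z := by
  classical
  -- Each flow is a homomorphism from `ℝ` to the permutations of `W`; these homomorphisms commute.
  let e : ∀ _ : ι, Multiplicative ℝ →* Equiv.Perm W := fun j => MonoidHom.mk' (fun t =>
    { toFun := fun z => ⟨φ j t.toAdd z, (hφ j).mem z z.2 _⟩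
      invFun := fun z => ⟨φ j (-t.toAdd) z, (hφ j).mem z z.2 _⟩
      left_inv := fun z => Subtype.ext <| by
        simp [← (hφ j).add_apply hW (hX j) _ _ z.2, (hφ j).zero z z.2]
      right_inv := fun z => Subtype.ext <| by
        simp [← (hφ j).add_apply hW (hX j) _ _ z.2, (hφ j).zero z z.2] })
    fun s t => by
      ext z
      exact (hφ j).add_apply hW (hX j) _ _ z.2
  have hcomm : ∀ i j, i ≠ j → ∀ x y, Commute (e i x) (e j y) := fun i j _ x y => by
    ext z
    exact (hφ i).commute (hφ j) hW (hX i) (hX j) (hbr i j) _ _ z.2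
  have hpw : ∀ (s : Finset ι) (t : ι → ℝ), (s : Set ι).Pairwise
      (Function.onFun Commute fun j => e j (Multiplicative.ofAdd (t j))) :=
    fun _ _ i _ j _ h => hcomm i j h _ _
  let P := MonoidHom.noncommPiCoprod e fun i j => hcomm i j
  have hcont : ∀ s : Finset ι, Continuous fun p : (ι → ℝ) × W =>
      (s.noncommProd (fun j => e j (Multiplicative.ofAdd (p.1 j)))
        (hpw _ _)) p.2 := by
    intro s
    induction s using Finset.induction_on with
    | empty =>
      refine continuous_snd.congr fun p => ?_
      rw [Finset.noncommProd_empty, Equiv.Perm.one_apply]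
    | insert i s hi ih =>
      refine Continuous.congr (Continuous.subtype_mk (f := fun p : (ι → ℝ) × W => φ i (p.1 i)
        ((s.noncommProd (fun j => e j (Multiplicative.ofAdd (p.1 j)))
          (hpw _ _)) p.2 : W)) (continuous_iff_continuousAt.2 fun p => ?_)
        fun p => (hφ i).mem _ (Subtype.coe_prop _) _) fun p => ?_
      swap
      · rw [Finset.noncommProd_insert_of_notMem _ _ _ _ hi]
        rfl
      exact ContinuousAt.comp (f := fun p : (ι → ℝ) × W => ((p.1 i,
        ((s.noncommProd (fun j => e j (Multiplicative.ofAdd (p.1 j)))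
          (hpw _ _)) p.2 : W)) : ℝ × E))
        ((hφ i).continuousAt hW (hX i) _ (Subtype.coe_prop _))
        (((continuous_apply i).comp continuous_fst).prodMk
          (continuous_subtype_val.comp ih)).continuousAt
  let Φ : (ι → ℝ) → E → E := fun t z =>
    if hz : z ∈ W then (P (fun j => Multiplicative.ofAdd (t j)) ⟨z, hz⟩ : W) else z
  have hΦ : ∀ t z (hz : z ∈ W), Φ t z = (P (fun j => Multiplicative.ofAdd (t j)) ⟨z, hz⟩ : W) :=
    fun t z hz => dif_pos hz
  have hmem : ∀ z ∈ W, ∀ t, Φ t z ∈ W := fun z hz t => by rw [hΦ t z hz]; exact Subtype.coe_prop _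
  have hadd : ∀ z ∈ W, ∀ s t, Φ (s + t) z = Φ s (Φ t z) := fun z hz s t => by
    rw [hΦ s _ (hmem z hz t), hΦ _ z hz]
    simp only [hΦ t z hz, Subtype.coe_eta]
    rw [← Equiv.Perm.mul_apply, ← map_mul]
    rfl
  have hsingle : ∀ z ∈ W, ∀ j t, Φ (Pi.single j t) z = φ j t z := fun z hz j t => by
    rw [hΦ _ z hz]
    have : (fun k => Multiplicative.ofAdd ((Pi.single j t : ι → ℝ) k)) =
        Pi.mulSingle j (Multiplicative.ofAdd t) := by
      ext k
      by_cases hk : k = j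
      · subst hk; simp
      · simp [hk]
    rw [this]
    exact congrArg (fun σ : Equiv.Perm W => (σ ⟨z, hz⟩ : E))
      (MonoidHom.noncommPiCoprod_mulSingle e j (Multiplicative.ofAdd t))
  refine ⟨Φ, ⟨hmem, fun z hz => ?_, hadd, fun z hz t => ?_⟩, hsingle⟩
  · rw [hΦ 0 z hz]
    exact congrArg (fun σ : Equiv.Perm W => (σ ⟨z, hz⟩ : E)) (map_one P)
  · have hc : Continuous fun t => Φ t z := by
      have := (continuous_subtype_val.comp (hcont Finset.univ)).comp
        (Continuous.prodMk continuous_id (continuous_const (y := (⟨z, hz⟩ : W))))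
      refine this.congr fun t => ?_
      rw [hΦ t z hz]
      rfl
    refine hasFDerivAt_of_hasDerivAt_single (g := fun j t => X j (Φ t z)) (fun j => ?_)
      fun j u => ?_
    · exact ContinuousAt.comp (((hX j).continuousOn).continuousAt (hW.mem_nhds (hmem z hz t)))
        hc.continuousAt
    · have h1 : (fun η => Φ (u + Pi.single j η) z) = fun η => φ j η (Φ u z) := by
        ext η
        rw [add_comm, hadd z hz, hsingle _ (hmem z hz u)]
      rw [h1]
      simpa [(hφ j).zero _ (hmem z hz u)] using (hφ j).hasDerivAt _ (hmem z hz u) 0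

end MultiFlow

/-! ### Pauli matrices and rotations -/

section Spin

attribute [local instance] Matrix.linftyOpNormedRing Matrix.linftyOpNormedAlgebra

theorem sigmaDot_eq (v : Spin) : sigmaDot v =
    !![(v 2 : ℂ), v 0 - v 1 * Complex.I; v 0 + v 1 * Complex.I, -(v 2 : ℂ)] := by
  ext i j
  fin_cases i <;> fin_cases j <;> simp [sigmaDot, pauli, Fin.sum_univ_three]
  ring

theorem sigmaDot_injective : Function.Injective sigmaDot := by
  intro v w h
  rw [sigmaDot_eq, sigmaDot_eq] at h
  have h00 := congrFun (congrFun h 0) 0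
  have h01 := congrFun (congrFun h 0) 1
  simp only [Matrix.of_apply, Matrix.cons_val', Matrix.cons_val_zero, Matrix.cons_val_one,
    Matrix.cons_val_fin_one, Complex.ext_iff, Complex.ofReal_re, Complex.sub_re, Complex.sub_im,
    Complex.mul_re, Complex.mul_im, Complex.ofReal_im, Complex.I_re, Complex.I_im] at h00 h01
  ext i
  fin_cases i
  · simpa using h01.1
  · simpa using h01.2
  · simpa using h00.1

theorem sigmaDot_add (v w : Spin) : sigmaDot (v + w) = sigmaDot v + sigmaDot w := by
  simp [sigmaDot, add_smul, Finset.sum_add_distrib]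

theorem sigmaDot_smul (c : ℝ) (v : Spin) : sigmaDot (c • v) = c • sigmaDot v := by
  ext i j
  simp [sigmaDot, Matrix.sum_apply, Finset.mul_sum, mul_assoc]

/-- `v ↦ v · σ` as a continuous real-linear map. -/
noncomputable def sigmaDotL : Spin →L[ℝ] Matrix (Fin 2) (Fin 2) ℂ :=
  LinearMap.toContinuousLinearMap
    { toFun := sigmaDot, map_add' := sigmaDot_add, map_smul' := sigmaDot_smul }

theorem sigmaDot_commutator (v w : Spin) :
    sigmaDot v * sigmaDot w - sigmaDot w * sigmaDot v =
      (2 * Complex.I) • sigmaDot (WithLp.toLp 2 (crossProduct v.ofLp w.ofLp)) := by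
  simp only [sigmaDot_eq, cross_apply]
  ext i j
  fin_cases i <;> fin_cases j <;> simp <;>
    ring_nf <;> simp only [Complex.I_sq] <;> ring

theorem det_sigmaDot (v : Spin) : (sigmaDot v).det = -((‖v‖ ^ 2 : ℝ) : ℂ) := by
  rw [sigmaDot_eq, Matrix.det_fin_two, EuclideanSpace.norm_sq_eq, Fin.sum_univ_three]
  simp only [Real.norm_eq_abs, sq_abs, Matrix.of_apply, Matrix.cons_val', Matrix.cons_val_zero,
    Matrix.cons_val_one, Matrix.cons_val_fin_one]
  push_cast
  linear_combination (v 1 : ℂ) ^ 2 * Complex.I_sq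

theorem SU2.mul_star_self (g : SU2) : g.1 * star g.1 = 1 :=
  Matrix.mem_unitaryGroup_iff.1 (Matrix.mem_specialUnitaryGroup_iff.1 g.2).1

theorem cover_mul (g h : SU2) (v : Spin) : cover (g * h) v = cover g (cover h v) := by
  apply sigmaDot_injective
  simp [sigmaDot_cover, mul_assoc]

theorem norm_cover (g : SU2) (v : Spin) : ‖cover g v‖ = ‖v‖ := by
  have h : (sigmaDot (cover g v)).det = (sigmaDot v).det := by
    rw [sigmaDot_cover, Matrix.det_mul, Matrix.det_mul, mul_right_comm, ← Matrix.det_mul,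
      SU2.mul_star_self, Matrix.det_one, one_mul]
  rw [det_sigmaDot, det_sigmaDot, neg_inj, Complex.ofReal_inj] at h
  exact (sq_eq_sq₀ (norm_nonneg _) (norm_nonneg _)).1 h

/-- The rotation of `ℝ³` covered by an element of `SU(2)`. -/
noncomputable def rotation (g : SU2) : Spin ≃ₗᵢ[ℝ] Spin :=
  LinearIsometry.toLinearIsometryEquiv
    { toFun := cover g
      map_add' := fun v w => sigmaDot_injective (by
        simp [sigmaDot_cover, sigmaDot_add, mul_add, add_mul])
      map_smul' := fun c v => sigmaDot_injective (by
        simp [sigmaDot_cover, sigmaDot_smul])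
      norm_map' := norm_cover g } rfl

theorem rotation_apply (g : SU2) (v : Spin) : rotation g v = cover g v := rfl

/-- Conjugation in `SU(2)` fixes the vectors `v` for which `v · σ` commutes with the element. -/
theorem cover_eq_self {g : SU2} {v : Spin} (h : g.1 * sigmaDot v = sigmaDot v * g.1) :
    cover g v = v := by
  apply sigmaDot_injective
  rw [sigmaDot_cover, h, mul_assoc, SU2.mul_star_self, mul_one]

/-- Every element of `SU(2)` is of the form `c + i v · σ` with `c` and `v` real. -/
theorem SU2.exists_eq_smul_one_add (g : SU2) :
    ∃ (c : ℝ) (v : Spin), g.1 = (c : ℂ) • 1 + Complex.I • sigmaDot v := by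
  have hdet := (Matrix.mem_specialUnitaryGroup_iff.1 g.2).2
  have hadj : star g.1 = g.1.adjugate := by
    have h1 : g.1.adjugate * g.1 = 1 := by rw [Matrix.adjugate_mul, hdet, one_smul]
    calc star g.1 = g.1.adjugate * g.1 * star g.1 := by rw [h1, one_mul]
      _ = g.1.adjugate := by rw [mul_assoc, SU2.mul_star_self, mul_one]
  have e00 := congrFun (congrFun hadj 0) 0
  have e01 := congrFun (congrFun hadj 0) 1
  simp only [Matrix.adjugate_fin_two, Matrix.star_apply, Complex.star_def, Complex.ext_iff,
    Complex.conj_re, Complex.conj_im, Matrix.of_apply, Matrix.cons_val', Matrix.cons_val_zero,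
    Matrix.cons_val_one, Matrix.cons_val_fin_one, Complex.neg_re, Complex.neg_im] at e00 e01
  refine ⟨(g.1 0 0).re, WithLp.toLp 2 ![(g.1 1 0).im, -(g.1 1 0).re, (g.1 0 0).im], ?_⟩
  rw [sigmaDot_eq]
  ext i j
  fin_cases i <;> fin_cases j <;> apply Complex.ext <;> simp <;>
    linarith [e00.1, e00.2, e01.1, e01.2]

/-- Commuting elements of `SU(2)` have a common axis. This fails in `SO(3)`, where the rotations by
`π` about two orthogonal axes commute. -/
theorem exists_common_axis (S : Set SU2) (hS : ∀ g ∈ S, ∀ h ∈ S, g * h = h * g) :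
    ∃ v : Spin, ‖v‖ = 1 ∧ ∀ g ∈ S, cover g v = v := by
  choose c a hca using SU2.exists_eq_smul_one_add
  by_cases h : ∃ g ∈ S, a g ≠ 0
  · obtain ⟨g, hg, hag⟩ := h
    refine ⟨(‖a g‖⁻¹ : ℝ) • a g, norm_smul_inv_norm hag, fun k hk => cover_eq_self ?_⟩
    have hcomm : k.1 * g.1 = g.1 * k.1 := congrArg Subtype.val (hS k hk g hg)
    have : k.1 * sigmaDot (a g) = sigmaDot (a g) * k.1 := by
      rw [hca g] at hcomm
      simp only [mul_add, add_mul, Matrix.mul_smul, Matrix.smul_mul, mul_one, one_mul,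
        add_right_inj] at hcomm
      exact smul_right_injective _ Complex.I_ne_zero hcomm
    rw [sigmaDot_smul, Matrix.mul_smul, this, Matrix.smul_mul]
  · push Not at h
    refine ⟨EuclideanSpace.single 0 1, by simp, fun k hk => cover_eq_self ?_⟩
    rw [hca k, h k hk]
    have h0 : sigmaDot 0 = 0 := map_zero sigmaDotL
    simp [h0]

/-- The polynomial formula for the rotation extends smoothly from `SU(2)` to all matrices. -/
theorem contDiff_cover_formula (v : Spin) : ContDiff ℝ ∞ fun m : Matrix (Fin 2) (Fin 2) ℂ =>
    (WithLp.toLp 2 fun a =>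
      (1 / 2 : ℝ) * (Matrix.trace (pauli a * (m * sigmaDot v * star m))).re : Spin) := by
  rw [contDiff_euclidean]
  intro a
  let L : Matrix (Fin 2) (Fin 2) ℂ →ₗ[ℝ] ℝ :=
    { toFun := fun m => (1 / 2 : ℝ) * (Matrix.trace (pauli a * m)).re
      map_add' := fun m n => by simp [mul_add]
      map_smul' := fun c m => by simp; ring }
  let S : Matrix (Fin 2) (Fin 2) ℂ →ₗ[ℝ] Matrix (Fin 2) (Fin 2) ℂ :=
    { toFun := star
      map_add' := star_add
      map_smul' := fun c m => by simp }
  exact L.toContinuousLinearMap.contDiff.comp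
    ((contDiff_id.mul contDiff_const).mul S.toContinuousLinearMap.contDiff)

theorem hasDerivAt_matrix {f : ℝ → Matrix (Fin 2) (Fin 2) ℂ} {f' : Matrix (Fin 2) (Fin 2) ℂ}
    {t : ℝ} (h : ∀ a b, HasDerivAt (fun τ => f τ a b) (f' a b) t) : HasDerivAt f f' t := by
  exact hasDerivAt_pi.2 fun a => hasDerivAt_pi.2 fun b => h a b

end Spin

/-! ### Hamiltonian vector fields and their lifts -/

section Hamiltonian

variable {d : ℕ}

/-- The map that turns the differential of a function into its Hamiltonian vector field. -/
noncomputable def symplecticDual (d : ℕ) : (Phase d →L[ℝ] ℝ) →L[ℝ] Phase d :=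
  LinearMap.toContinuousLinearMap
    { toFun := fun l => (WithLp.toLp 2 fun i => -l (0, EuclideanSpace.single i 1),
        WithLp.toLp 2 fun i => l (EuclideanSpace.single i 1, 0))
      map_add' := fun l m => by
        ext i <;> simp [add_comm]
      map_smul' := fun c l => by
        ext i <;> simp }

theorem hamiltonianVectorField_eq (A : Phase d → ℝ) (z : Phase d) :
    hamiltonianVectorField A z = symplecticDual d (fderiv ℝ A z) := rfl

theorem phase_eq_sum (v : Phase d) : v = ∑ i, v.1 i • (EuclideanSpace.single i (1 : ℝ), (0 :
    EuclideanSpace ℝ (Fin d))) + ∑ i, v.2 i • ((0 : EuclideanSpace ℝ (Fin d)),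
      EuclideanSpace.single i (1 : ℝ)) := by
  ext i <;> simp [Prod.fst_sum, Prod.snd_sum, Finset.sum_apply, Pi.single_apply]

/-- In terms of differentials, the Poisson bracket of functions with differentials `l` and `m` is
`m (symplecticDual d l)`. -/
theorem clm_symplecticDual (l m : Phase d →L[ℝ] ℝ) : m (symplecticDual d l) =
    ∑ i, (l (EuclideanSpace.single i 1, 0) * m (0, EuclideanSpace.single i 1) -
      l (0, EuclideanSpace.single i 1) * m (EuclideanSpace.single i 1, 0)) := by
  rw [phase_eq_sum (symplecticDual d l), map_add, map_sum, map_sum, ← Finset.sum_add_distrib]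
  refine Finset.sum_congr rfl fun i _ => ?_
  simp only [map_smul, smul_eq_mul]
  change -l _ * m _ + l _ * m _ = _
  ring

theorem clm_symplecticDual_swap (l m : Phase d →L[ℝ] ℝ) :
    m (symplecticDual d l) = -l (symplecticDual d m) := by
  rw [clm_symplecticDual, clm_symplecticDual, ← Finset.sum_neg_distrib]
  exact Finset.sum_congr rfl fun i _ => by ring

theorem symplecticDual_injective : Function.Injective (symplecticDual d) := by
  intro l m h
  refine ContinuousLinearMap.ext fun v => ?_
  rw [phase_eq_sum v]
  have h1 : ∀ i, l (EuclideanSpace.single i 1, 0) = m (EuclideanSpace.single i 1, 0) := fun i =>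
    congrArg (fun v : Phase d => v.2 i) h
  have h2 : ∀ i, l (0, EuclideanSpace.single i 1) = m (0, EuclideanSpace.single i 1) := fun i =>
    neg_injective (congrArg (fun v : Phase d => v.1 i) h)
  simp only [map_add, map_sum, map_smul, h1, h2]

theorem poisson_eq_fderiv (f g : Phase d → ℝ) (z : Phase d) :
    poisson f g z = fderiv ℝ g z (hamiltonianVectorField f z) := by
  rw [hamiltonianVectorField_eq, clm_symplecticDual]
  rfl

theorem poisson_swap (f g : Phase d → ℝ) (z : Phase d) : poisson f g z = -poisson g f z := by
  rw [poisson_eq_fderiv, poisson_eq_fderiv, hamiltonianVectorField_eq, clm_symplecticDual_swap,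
    hamiltonianVectorField_eq]

variable {U : Set (Phase d)} {f g : Phase d → ℝ}

theorem contDiffOn_hamiltonianVectorField (hU : IsOpen U) (hf : ContDiffOn ℝ ∞ f U) :
    ContDiffOn ℝ ∞ (hamiltonianVectorField f) U :=
  (symplecticDual d).contDiff.comp_contDiffOn (hf.fderiv_of_isOpen hU (by simp))

theorem hasFDerivAt_hamiltonianVectorField (hU : IsOpen U) (hf : ContDiffOn ℝ ∞ f U) {z : Phase d}
    (hz : z ∈ U) : HasFDerivAt (hamiltonianVectorField f)
      ((symplecticDual d).comp (fderiv ℝ (fderiv ℝ f) z)) z :=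
  (symplecticDual d).hasFDerivAt.comp z
    (((hf.fderiv_of_isOpen hU (m := ∞) (by simp)).differentiableOn (by simp)).differentiableAt
      (hU.mem_nhds hz)).hasFDerivAt

/-- The Hamiltonian vector fields of two functions in involution commute. -/
theorem fderiv_hamiltonianVectorField_comm (hU : IsOpen U) (hf : ContDiffOn ℝ ∞ f U)
    (hg : ContDiffOn ℝ ∞ g U) (hfg : ∀ z ∈ U, poisson f g z = 0) {z : Phase d} (hz : z ∈ U) :
    fderiv ℝ (hamiltonianVectorField f) z (hamiltonianVectorField g z) =
      fderiv ℝ (hamiltonianVectorField g) z (hamiltonianVectorField f z) := by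
  rw [(hasFDerivAt_hamiltonianVectorField hU hf hz).fderiv,
    (hasFDerivAt_hamiltonianVectorField hU hg hz).fderiv]
  simp only [ContinuousLinearMap.comp_apply]
  congr 1
  refine ContinuousLinearMap.ext fun v => ?_
  have hsymm : ∀ h : Phase d → ℝ, ContDiffOn ℝ ∞ h U → ∀ v w : Phase d,
      fderiv ℝ (fderiv ℝ h) z v w = fderiv ℝ (fderiv ℝ h) z w v := fun h hh v w =>
    ((hh.contDiffAt (hU.mem_nhds hz)).isSymmSndFDerivAt (by
      rw [minSmoothness_of_isRCLikeNormedField]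
      exact ENat.LEInfty.out)).eq v w
  -- Differentiating `{f, g} = 0` gives `D²g(X_f, v) = D²f(X_g, v)` for all `v`.
  have hd : HasFDerivAt (fun w => fderiv ℝ g w (hamiltonianVectorField f w))
      (0 : Phase d →L[ℝ] ℝ) z := by
    refine (hasFDerivAt_const (0 : ℝ) z).congr_of_eventuallyEq ?_
    filter_upwards [hU.mem_nhds hz] with w hw
    rw [← poisson_eq_fderiv, hfg w hw]
  have hd' := HasFDerivAt.clm_apply
    (((hg.fderiv_of_isOpen hU (m := ∞) (by simp)).differentiableOn (by simp)).differentiableAt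
      (hU.mem_nhds hz)).hasFDerivAt (hasFDerivAt_hamiltonianVectorField hU hf hz)
  have h0 := DFunLike.congr_fun (hd.unique hd') v
  simp only [zero_apply, add_apply,
    ContinuousLinearMap.comp_apply, ContinuousLinearMap.flip_apply] at h0
  rw [clm_symplecticDual_swap, ← hamiltonianVectorField_eq] at h0
  rw [hsymm f hf, hsymm g hg]
  linarith

end Hamiltonian

section MatrixIdentities

variable {n : Type*} [Fintype n]

theorem neg_smul_mul_assoc (c : ℂ) (a b m : Matrix n n ℂ) :
    -(c • (a * b)) * m = -(c • (a * (b * m))) := by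
  simp [Matrix.mul_assoc]

theorem lift_commutator_identity (c : ℂ) (a b e m : Matrix n n ℂ) :
    a * -(c • (b * m)) + e * m = b * -(c • (a * m)) + (e + (-c) • (a * b - b * a)) * m := by
  simp only [add_mul, sub_mul, Matrix.mul_neg, Matrix.mul_smul, Matrix.smul_mul, smul_sub,
    neg_smul, Matrix.mul_assoc, Matrix.neg_mul]
  abel

end MatrixIdentities

section Lift

attribute [local instance] Matrix.linftyOpNormedRing Matrix.linftyOpNormedAlgebra

variable {d : ℕ} {U : Set (Phase d)}

theorem fderiv_euclidean_apply {B : Phase d → Spin} {z : Phase d} (hB : DifferentiableAt ℝ B z)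
    (a : Fin 3) (v : Phase d) : fderiv ℝ (fun w => B w a) z v = fderiv ℝ B z v a :=
  DFunLike.congr_fun
    ((EuclideanSpace.proj (𝕜 := ℝ) a).hasFDerivAt.comp z hB.hasFDerivAt).fderiv v

/-- The vector field on `Phase d × ℂ^{2×2}` whose flow is the Hamiltonian flow together with the
spin transporter, acting from the left. -/
noncomputable def SkewProduct.lift (Y : SkewProduct d U) (q : Phase d × Matrix (Fin 2) (Fin 2) ℂ) :
    Phase d × Matrix (Fin 2) (Fin 2) ℂ :=
  (hamiltonianVectorField Y.A q.1, -((Complex.I / 2) • (sigmaDot (Y.B q.1) * q.2)))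

theorem SkewProduct.differentiableAt_B (hU : IsOpen U) (Y : SkewProduct d U) {z : Phase d}
    (hz : z ∈ U) : DifferentiableAt ℝ Y.B z :=
  (Y.smooth_B.differentiableOn (by simp)).differentiableAt (hU.mem_nhds hz)

theorem SkewProduct.contDiffOn_lift (hU : IsOpen U) (Y : SkewProduct d U) :
    ContDiffOn ℝ ∞ Y.lift (U ×ˢ univ) := by
  have hfst : MapsTo Prod.fst (U ×ˢ (univ : Set (Matrix (Fin 2) (Fin 2) ℂ))) U := fun q hq => hq.1
  refine ((contDiffOn_hamiltonianVectorField hU Y.smooth_A).comp contDiffOn_fst hfst).prodMk ?_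
  refine ContDiffOn.neg (ContDiffOn.const_smul _ (ContDiffOn.mul ?_ contDiffOn_snd))
  exact sigmaDotL.contDiff.comp_contDiffOn (Y.smooth_B.comp contDiffOn_fst hfst)

theorem SkewProduct.fderiv_lift (hU : IsOpen U) (Y : SkewProduct d U) {z : Phase d} (hz : z ∈ U)
    (m : Matrix (Fin 2) (Fin 2) ℂ) (q : Phase d × Matrix (Fin 2) (Fin 2) ℂ) :
    fderiv ℝ Y.lift (z, m) q = (fderiv ℝ (hamiltonianVectorField Y.A) z q.1,
      -((Complex.I / 2) • (sigmaDot (Y.B z) * q.2 + sigmaDot (fderiv ℝ Y.B z q.1) * m))) := by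
  have h1 : HasFDerivAt (fun q : Phase d × Matrix (Fin 2) (Fin 2) ℂ => sigmaDot (Y.B q.1))
      ((sigmaDotL.comp (fderiv ℝ Y.B z)).comp (ContinuousLinearMap.fst ℝ _ _)) (z, m) :=
    HasFDerivAt.comp (g := fun w => sigmaDotL (Y.B w)) (z, m)
      (sigmaDotL.hasFDerivAt.comp z (Y.differentiableAt_B hU hz).hasFDerivAt) hasFDerivAt_fst
  have h2 := ((h1.mul' hasFDerivAt_snd).const_smul (Complex.I / 2)).neg
  have h3 : HasFDerivAt (fun q : Phase d × Matrix (Fin 2) (Fin 2) ℂ =>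
      hamiltonianVectorField Y.A q.1) _ (z, m) :=
    HasFDerivAt.comp (g := hamiltonianVectorField Y.A) (z, m)
      (hasFDerivAt_hamiltonianVectorField hU Y.smooth_A hz) hasFDerivAt_fst
  rw [(hasFDerivAt_hamiltonianVectorField hU Y.smooth_A hz).fderiv, 
    show fderiv ℝ Y.lift (z, m) = _ from (h3.prodMk h2).fderiv]
  rfl

theorem fderiv_B_of_spinBracket_eq_zero (hU : IsOpen U) (Y Y' : SkewProduct d U) {z : Phase d}
    (hz : z ∈ U) (h : ∀ a, spinBracket Y Y' z a = 0) :
    fderiv ℝ Y'.B z (hamiltonianVectorField Y.A z) =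
      fderiv ℝ Y.B z (hamiltonianVectorField Y'.A z) +
        WithLp.toLp 2 (crossProduct (Y.B z).ofLp (Y'.B z).ofLp) := by
  ext a
  have := h a
  rw [spinBracket, poisson_swap _ Y'.A, poisson_eq_fderiv, poisson_eq_fderiv,
    fderiv_euclidean_apply (Y.differentiableAt_B hU hz),
    fderiv_euclidean_apply (Y'.differentiableAt_B hU hz)] at this
  simp only [PiLp.add_apply]
  linarith

/-- The spin part of the bracket vanishes because the commutator of `B_j · σ` and `B_k · σ` is
`2i (B_j × B_k) · σ`. -/
theorem fderiv_lift_comm (hU : IsOpen U) (Y Y' : SkewProduct d U)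
    (hA : ∀ z ∈ U, poisson Y.A Y'.A z = 0) (hB : ∀ z ∈ U, ∀ a, spinBracket Y Y' z a = 0)
    {q : Phase d × Matrix (Fin 2) (Fin 2) ℂ} (hq : q ∈ U ×ˢ (univ : Set _)) :
    fderiv ℝ Y.lift q (Y'.lift q) = fderiv ℝ Y'.lift q (Y.lift q) := by
  obtain ⟨z, m⟩ := q
  have hz : z ∈ U := hq.1
  rw [Y.fderiv_lift hU hz, Y'.fderiv_lift hU hz]
  refine Prod.ext (fderiv_hamiltonianVectorField_comm hU Y.smooth_A Y'.smooth_A hA hz) ?_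
  have hcross : sigmaDot (WithLp.toLp 2 (crossProduct (Y.B z).ofLp (Y'.B z).ofLp)) =
      (-(Complex.I / 2)) • (sigmaDot (Y.B z) * sigmaDot (Y'.B z) -
        sigmaDot (Y'.B z) * sigmaDot (Y.B z)) := by
    rw [sigmaDot_commutator, smul_smul]
    rw [show -(Complex.I / 2) * (2 * Complex.I) = 1 by linear_combination -Complex.I_sq, one_smul]
  simp only [SkewProduct.lift, fderiv_B_of_spinBracket_eq_zero hU Y Y' hz (hB z hz), sigmaDot_add,
    hcross]
  congr 2
  exact lift_commutator_identity _ _ _ _ _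

theorem SkewProduct.isFlowOn_lift (Y : SkewProduct d U) :
    IsFlowOn Y.lift (U ×ˢ univ) fun t q => (Y.φ t q.1, (Y.g q.1 t).1 * q.2) where
  mem q hq t := ⟨Y.flow_mem _ hq.1 t, mem_univ _⟩
  zero q hq := by
    ext1
    · exact Y.flow_zero _ hq.1
    · simp [Y.transport_zero _ hq.1]
  hasDerivAt q hq t := by
    refine (Y.hamilton _ hq.1 t).prodMk ?_
    have := (hasDerivAt_matrix (f' := -((Complex.I / 2) • (sigmaDot (Y.B (Y.φ t q.1)) *
      (Y.g q.1 t).1))) fun a b => Y.transport _ hq.1 t a b).mul_const q.2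
    rw [neg_smul_mul_assoc] at this
    exact this

end Lift

/-! ### The spin action and local times on level sets -/

section SpinAction

variable {d : ℕ} {U : Set (Phase d)}

/-- The skew products `Z j` generate the action of `ℝ^d` on `U × SU(2)` that consists of the
action `Φ` on `U` and the cocycle `D` with values in `SU(2)`. -/
structure IsSpinAction (Z : Fin d → SkewProduct d U) (Φ : (Fin d → ℝ) → Phase d → Phase d)
    (D : Phase d → (Fin d → ℝ) → SU2) : Prop where
  flow : IsMultiFlowOn (fun j => hamiltonianVectorField (Z j).A) U Φ
  flow_single : ∀ z ∈ U, ∀ j t, Φ (Pi.single j t) z = (Z j).φ t z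
  cocycle_single : ∀ z ∈ U, ∀ j t, D z (Pi.single j t) = (Z j).g z t
  cocycle_add : ∀ z ∈ U, ∀ s t, D z (s + t) = D (Φ t z) s * D z t
  contDiff_cover : ∀ z ∈ U, ∀ v, ContDiff ℝ ∞ fun t => cover (D z t) v

attribute [local instance] Matrix.linftyOpNormedRing Matrix.linftyOpNormedAlgebra

theorem exists_isSpinAction (hU : IsOpen U) (Z : Fin d → SkewProduct d U)
    (hA : ∀ j k, ∀ z ∈ U, poisson (Z j).A (Z k).A z = 0)
    (hB : ∀ j k, ∀ z ∈ U, ∀ a, spinBracket (Z j) (Z k) z a = 0) :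
    ∃ Φ D, IsSpinAction Z Φ D := by
  classical
  obtain ⟨Ψ, hΨ, hsingle⟩ := exists_isMultiFlowOn (X := fun j => (Z j).lift)
    (hU.prod isOpen_univ) (fun j => ((Z j).contDiffOn_lift hU).of_le (by simp))
    (fun j => (Z j).isFlowOn_lift)
    fun j k w hw => fderiv_lift_comm hU (Z j) (Z k) (hA j k) (hB j k) hw
  have hmem : ∀ z ∈ U, ∀ m : Matrix (Fin 2) (Fin 2) ℂ,
      (z, m) ∈ U ×ˢ (univ : Set (Matrix (Fin 2) (Fin 2) ℂ)) := fun z hz m => ⟨hz, mem_univ _⟩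
  -- The lifted action is equivariant under right multiplication, so it is given by left
  -- multiplication with elements of `SU(2)`.
  have key : ∀ t : Fin d → ℝ, ∀ z ∈ U, ∀ m, Ψ t (z, m) = ((Ψ t (z, 1)).1, (Ψ t (z, 1)).2 * m) ∧
      (Ψ t (z, 1)).2 ∈ Matrix.specialUnitaryGroup (Fin 2) ℂ := by
    intro t
    refine Pi.single_induction (M := fun _ : Fin d => ℝ) (fun t : Fin d → ℝ => ∀ z ∈ U, ∀ m,
      Ψ t (z, m) = ((Ψ t (z, 1)).1, (Ψ t (z, 1)).2 * m) ∧
      (Ψ t (z, 1)).2 ∈ Matrix.specialUnitaryGroup (Fin 2) ℂ) t ?_ ?_ ?_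
    · intro z hz m
      rw [hΨ.zero _ (hmem z hz _), hΨ.zero _ (hmem z hz _)]
      exact ⟨by rw [Matrix.one_mul], one_mem _⟩
    · intro s t hs ht z hz m
      have hz' : (Ψ t (z, 1)).1 ∈ U := (hΨ.mem _ (hmem z hz 1) t).1
      have e : ∀ m, Ψ (s + t) (z, m) = ((Ψ s ((Ψ t (z, 1)).1, 1)).1,
          (Ψ s ((Ψ t (z, 1)).1, 1)).2 * ((Ψ t (z, 1)).2 * m)) := fun m => by
        rw [hΨ.add _ (hmem z hz _), (ht z hz m).1, (hs _ hz' _).1]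
      rw [e m, e 1]
      refine ⟨by rw [Matrix.mul_one, Matrix.mul_assoc], ?_⟩
      rw [Matrix.mul_one]
      exact mul_mem (hs _ hz' 1).2 (ht _ hz 1).2
    · intro j t z hz m
      rw [hsingle _ (hmem z hz _), hsingle _ (hmem z hz _)]
      exact ⟨by rw [Matrix.mul_one], by rw [Matrix.mul_one]; exact ((Z j).g z t).2⟩
  let D : Phase d → (Fin d → ℝ) → SU2 := fun z t =>
    if hz : z ∈ U then ⟨(Ψ t (z, 1)).2, (key t z hz 1).2⟩ else 1
  have hD : ∀ z ∈ U, ∀ t, (D z t).1 = (Ψ t (z, 1)).2 := fun z hz t => by simp only [D, dif_pos hz]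
  refine ⟨fun t z => (Ψ t (z, 1)).1, D, ⟨fun z hz t => (hΨ.mem _ (hmem z hz 1) t).1,
    fun z hz => by rw [hΨ.zero _ (hmem z hz _)], fun z hz s t => ?_, fun z hz t => ?_⟩,
    fun z hz j t => by rw [hsingle _ (hmem z hz _)], fun z hz j t => Subtype.ext ?_,
    fun z hz s t => Subtype.ext ?_, fun z hz v => ?_⟩
  · have hz' : (Ψ t (z, 1)).1 ∈ U := (hΨ.mem _ (hmem z hz 1) t).1
    rw [hΨ.add _ (hmem z hz _), (key s _ hz' (Ψ t (z, 1)).2).1]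
  · have h1 := (hΨ.hasFDerivAt _ (hmem z hz 1) t).fst
    convert! h1 using 1
    refine ContinuousLinearMap.ext fun u => ?_
    simp [SkewProduct.lift]
  · rw [hD z hz, hsingle _ (hmem z hz _), Matrix.mul_one]
  · have hz' : (Ψ t (z, 1)).1 ∈ U := (hΨ.mem _ (hmem z hz 1) t).1
    rw [hD z hz, hΨ.add _ (hmem z hz _), (key s _ hz' (Ψ t (z, 1)).2).1, Submonoid.coe_mul,
      hD _ hz', hD z hz]
  · have h1 := (contDiff_cover_formula v).comp (contDiff_snd.comp
      (hΨ.contDiff (fun j => (Z j).contDiffOn_lift hU) (hmem z hz 1)))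
    refine Eq.mp (congrArg (ContDiff ℝ ∞) (funext fun t => ?_)) h1
    simp only [Function.comp_apply, ← hD z hz t]
    rfl

theorem IsSpinAction.cocycle_zero {Z : Fin d → SkewProduct d U}
    {Φ : (Fin d → ℝ) → Phase d → Phase d} {D : Phase d → (Fin d → ℝ) → SU2}
    (h : IsSpinAction Z Φ D) {z : Phase d} (hz : z ∈ U) : D z 0 = 1 := by
  have := h.cocycle_add z hz 0 0
  rw [add_zero, h.flow.zero z hz] at this
  exact (mul_eq_left.1 this.symm)

end SpinAction

section LevelSets

variable {d : ℕ} {U : Set (Phase d)} {A : Fin d → Phase d → ℝ}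
  {Φ : (Fin d → ℝ) → Phase d → Phase d}

theorem IsMultiFlowOn.conserved (hU : IsOpen U) (hA : ∀ j, ContDiffOn ℝ ∞ (A j) U)
    (hinv : ∀ j k, ∀ z ∈ U, poisson (A j) (A k) z = 0)
    (hΦ : IsMultiFlowOn (fun j => hamiltonianVectorField (A j)) U Φ) {z : Phase d} (hz : z ∈ U)
    (k : Fin d) (t : Fin d → ℝ) : A k (Φ t z) = A k z := by
  have hd : ∀ t, HasFDerivAt (fun t => A k (Φ t z)) (0 : (Fin d → ℝ) →L[ℝ] ℝ) t := fun t => by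
    have hm := hΦ.mem z hz t
    have h1 : HasFDerivAt (fun t => A k (Φ t z)) _ t := HasFDerivAt.comp (g := A k) t
      (((hA k).differentiableOn (by simp)).differentiableAt (hU.mem_nhds hm)).hasFDerivAt
      (hΦ.hasFDerivAt z hz t)
    convert! h1 using 1
    refine ContinuousLinearMap.ext fun u => ?_
    simp [map_sum, ← poisson_eq_fderiv, hinv _ k _ hm]
  have := is_const_of_fderiv_eq_zero (𝕜 := ℝ) (fun t => (hd t).differentiableAt)
    (fun t => (hd t).fderiv) t 0
  simpa [hΦ.zero z hz] using this

/-- Linearly independent functionals are the components of a surjective map. -/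
theorem surjective_pi_of_linearIndependent {E : Type*} [AddCommGroup E] [Module ℝ E]
    {l : Fin d → E →ₗ[ℝ] ℝ} (hl : LinearIndependent ℝ l) :
    Function.Surjective (LinearMap.pi l) := by
  rw [← LinearMap.range_eq_top]
  by_contra hne
  obtain ⟨f, hf, hle⟩ := Submodule.exists_le_ker_of_lt_top _ (lt_top_iff_ne_top.2 hne)
  refine hf ?_
  have hc : ∀ j, f (fun i => if j = i then 1 else 0) = 0 := by
    refine Fintype.linearIndependent_iff.1 hl (fun j => f fun i => if j = i then 1 else 0) ?_
    ext v
    have h0 : f (LinearMap.pi l v) = 0 := hle ⟨v, rfl⟩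
    rw [LinearMap.pi_apply_eq_sum_univ] at h0
    simpa [mul_comm] using h0
  refine LinearMap.ext fun x => ?_
  rw [LinearMap.pi_apply_eq_sum_univ]
  simp [hc]

theorem injective_sum_smulRight_hamiltonianVectorField {z : Phase d}
    (hind : LinearIndependent ℝ fun j => fderiv ℝ (A j) z) :
    Function.Injective (∑ j, (ContinuousLinearMap.proj (R := ℝ) (φ := fun _ : Fin d => ℝ)
      j).smulRight (hamiltonianVectorField (A j) z) : (Fin d → ℝ) →L[ℝ] Phase d) := by
  refine (injective_iff_map_eq_zero _).2 fun t ht => ?_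
  have h : symplecticDual d (∑ j, t j • fderiv ℝ (A j) z) = symplecticDual d 0 := by
    rw [map_zero, ← ht]
    simp [hamiltonianVectorField_eq, map_sum]
  exact funext (Fintype.linearIndependent_iff.1 hind t (symplecticDual_injective h))

/-- Local form of the Liouville–Arnold theorem: near a regular point `z₀`, every point `w` of the
level set of `z₀` is reached from `z₀` at a time `τ w` that depends smoothly on `w`. -/
theorem IsMultiFlowOn.exists_local_time (hU : IsOpen U) (hA : ∀ j, ContDiffOn ℝ ∞ (A j) U)
    (hinv : ∀ j k, ∀ z ∈ U, poisson (A j) (A k) z = 0)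
    (hΦ : IsMultiFlowOn (fun j => hamiltonianVectorField (A j)) U Φ) {z₀ : Phase d} (hz₀ : z₀ ∈ U)
    (hind : LinearIndependent ℝ fun j => fderiv ℝ (A j) z₀) :
    ∃ V : Set (Phase d), IsOpen V ∧ z₀ ∈ V ∧ ∃ τ : Phase d → Fin d → ℝ, ContDiffOn ℝ ∞ τ V ∧
      (∀ w ∈ V, (∀ j, A j w = A j z₀) → Φ (τ w) z₀ = w) ∧
      ∀ᶠ t in 𝓝 0, Φ t z₀ ∈ V ∧ τ (Φ t z₀) = t := by
  -- `L` is the derivative of the orbit map, with image the common kernel of the `dA_j`; a right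
  -- inverse `G` of the `dA_j` provides complementary directions, and `Ξ` is a chart.
  set L : (Fin d → ℝ) →L[ℝ] Phase d := ∑ j, (ContinuousLinearMap.proj (R := ℝ)
    (φ := fun _ : Fin d => ℝ) j).smulRight (hamiltonianVectorField (A j) z₀) with hL
  set dA : Phase d →L[ℝ] (Fin d → ℝ) := ContinuousLinearMap.pi fun j => fderiv ℝ (A j) z₀ with hdA
  have hdAL : ∀ t, dA (L t) = 0 := fun t => by
    ext k
    simp [hdA, hL, map_sum, ← poisson_eq_fderiv, hinv _ k _ hz₀]
  have hLinj := injective_sum_smulRight_hamiltonianVectorField hind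
  have hsurj : Function.Surjective dA := by
    refine surjective_pi_of_linearIndependent (l := fun j => (fderiv ℝ (A j) z₀ : Phase d →ₗ[ℝ] ℝ))
      ?_
    rw [Fintype.linearIndependent_iff] at hind ⊢
    intro c hc
    refine hind c (ContinuousLinearMap.ext fun v => ?_)
    simpa using DFunLike.congr_fun hc v
  obtain ⟨G', hG'⟩ := LinearMap.exists_rightInverse_of_surjective (dA : Phase d →ₗ[ℝ] Fin d → ℝ)
    (LinearMap.range_eq_top.2 hsurj)
  set G : (Fin d → ℝ) →L[ℝ] Phase d := LinearMap.toContinuousLinearMap G' with hG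
  have hdAG : ∀ y, dA (G y) = y := fun y => DFunLike.congr_fun hG' y
  have hMinj : Function.Injective (L.coprod G : (Fin d → ℝ) × (Fin d → ℝ) →ₗ[ℝ] Phase d) := by
    rw [← LinearMap.ker_eq_bot, LinearMap.ker_eq_bot']
    rintro ⟨t, y⟩ hp
    have hp' : L t + G y = 0 := by simpa using hp
    have hy : y = 0 := by
      have := congrArg dA hp'
      rwa [map_add, hdAL, hdAG, zero_add, map_zero] at this
    rw [hy, map_zero, add_zero] at hp'
    rw [hy, hLinj (hp'.trans (map_zero L).symm)]
    rfl
  let M : ((Fin d → ℝ) × (Fin d → ℝ)) ≃L[ℝ] Phase d :=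
    (LinearMap.linearEquivOfInjective _ hMinj (by simp)).toContinuousLinearEquiv
  have hM : (M : ((Fin d → ℝ) × (Fin d → ℝ)) →L[ℝ] Phase d) = L.coprod G := by
    ext1 <;> rfl
  have hf := hΦ.contDiff (fun j => contDiffOn_hamiltonianVectorField hU (hA j)) hz₀
  let Ξ : (Fin d → ℝ) × (Fin d → ℝ) → Phase d := fun p => Φ p.1 z₀ + G p.2
  have hΞ : ContDiff ℝ ∞ Ξ := (hf.comp contDiff_fst).add (G.contDiff.comp contDiff_snd)
  have hΞ0 : Ξ 0 = z₀ := by simp [Ξ, hΦ.zero z₀ hz₀]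
  have hΞ' : HasFDerivAt Ξ (M : ((Fin d → ℝ) × (Fin d → ℝ)) →L[ℝ] Phase d) 0 := by
    have h0 := hΦ.hasFDerivAt z₀ hz₀ 0
    rw [hΦ.zero z₀ hz₀] at h0
    have h1 := (HasFDerivAt.comp (g := fun t => Φ t z₀) (0 : (Fin d → ℝ) × (Fin d → ℝ)) h0
      hasFDerivAt_fst).add (G.hasFDerivAt.comp _ hasFDerivAt_snd)
    rw [hM]
    convert! h1 using 1
  have hΞs : HasStrictFDerivAt Ξ (M : ((Fin d → ℝ) × (Fin d → ℝ)) →L[ℝ] Phase d) 0 :=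
    hΞ.contDiffAt.hasStrictFDerivAt' hΞ' (by simp)
  -- The map `(t, y) ↦ (t, A (Ξ (t, y)))` is injective near `0`, its derivative being the identity.
  -- As `A` is constant along the action, points of the level set of `z₀` have `y = 0`.
  let Q : (Fin d → ℝ) × (Fin d → ℝ) → (Fin d → ℝ) × (Fin d → ℝ) :=
    fun p => (p.1, fun j => A j (Ξ p))
  have hQ : HasStrictFDerivAt Q ((ContinuousLinearEquiv.refl ℝ ((Fin d → ℝ) × (Fin d → ℝ)) :
      ((Fin d → ℝ) × (Fin d → ℝ)) ≃L[ℝ] _) : ((Fin d → ℝ) × (Fin d → ℝ)) →L[ℝ] _) 0 := by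
    have h1 : HasStrictFDerivAt (fun p j => A j (Ξ p)) (dA.comp
        (M : ((Fin d → ℝ) × (Fin d → ℝ)) →L[ℝ] Phase d)) 0 := by
      refine hasStrictFDerivAt_pi'.2 fun j => ?_
      have hAj : HasStrictFDerivAt (A j) (fderiv ℝ (A j) z₀) (Ξ 0) := by
        rw [hΞ0]
        exact ((hA j).contDiffAt (hU.mem_nhds hz₀)).hasStrictFDerivAt (by simp)
      exact hAj.comp 0 hΞs
    have h2 := (hasStrictFDerivAt_fst (𝕜 := ℝ) (p := (0 : (Fin d → ℝ) × (Fin d → ℝ)))).prodMk h1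
    convert! h2 using 1
    refine ContinuousLinearMap.ext fun p => Prod.ext rfl ?_
    change p.2 = dA (L p.1 + G p.2)
    rw [map_add, hdAL, hdAG, zero_add]
  let e := hΞs.toOpenPartialHomeomorph Ξ
  let q := hQ.toOpenPartialHomeomorph Q
  obtain ⟨r, hr, hrq⟩ := Metric.isOpen_iff.1 q.open_source 0
    (hQ.mem_toOpenPartialHomeomorph_source)
  let S : Set ((Fin d → ℝ) × (Fin d → ℝ)) := ball 0 r ∩
    (fderiv ℝ Ξ) ⁻¹' range ((↑) : (((Fin d → ℝ) × (Fin d → ℝ)) ≃L[ℝ] Phase d) → _)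
  have hSo : IsOpen S := isOpen_ball.inter
    (ContinuousLinearEquiv.isOpen.preimage (hΞ.continuous_fderiv (by simp)))
  have hS0 : (0 : (Fin d → ℝ) × (Fin d → ℝ)) ∈ S := ⟨mem_ball_self hr, M, hΞ'.fderiv.symm⟩
  have he0 : (0 : (Fin d → ℝ) × (Fin d → ℝ)) ∈ e.source := hΞs.mem_toOpenPartialHomeomorph_source
  have hecoe : ∀ p, e p = Ξ p := fun p => rfl
  refine ⟨e.target ∩ e.symm ⁻¹' S, e.isOpen_inter_preimage_symm hSo, ?_, fun w => (e.symm w).1,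
    ?_, ?_, ?_⟩
  · rw [← hΞ0, ← hecoe]
    refine ⟨e.map_source he0, ?_⟩
    rw [mem_preimage, e.left_inv he0]
    exact hS0
  · refine contDiff_fst.comp_contDiffOn fun w hw => ContDiffAt.contDiffWithinAt ?_
    obtain ⟨N, hN⟩ := hw.2.2
    refine e.contDiffAt_symm hw.1 (f₀' := N) ?_ hΞ.contDiffAt
    rw [hN]
    exact (hΞ.differentiable (by simp) _).hasFDerivAt
  · intro w hw hlev
    have hΞw : Ξ (e.symm w) = w := e.right_inv hw.1
    have hb := mem_ball_zero_iff.1 hw.2.1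
    have hb' : ((e.symm w).1, (0 : Fin d → ℝ)) ∈ ball (0 : (Fin d → ℝ) × (Fin d → ℝ)) r := by
      rw [mem_ball_zero_iff, Prod.norm_mk, norm_zero, max_eq_left (norm_nonneg _)]
      exact (norm_fst_le _).trans_lt hb
    have hΞt : Ξ ((e.symm w).1, 0) = Φ (e.symm w).1 z₀ := by simp [Ξ]
    have hQeq : Q (e.symm w) = Q ((e.symm w).1, 0) := by
      refine Prod.ext rfl (funext fun j => ?_)
      change A j (Ξ (e.symm w)) = A j (Ξ ((e.symm w).1, 0))
      rw [hΞw, hlev, hΞt, hΦ.conserved hU hA hinv hz₀]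
    have := q.injOn (hrq hw.2.1) (hrq hb') hQeq
    rw [← hΞt, ← this, hΞw]
  · have hc : ContinuousAt (fun t : Fin d → ℝ => (t, (0 : Fin d → ℝ))) 0 := by fun_prop
    filter_upwards [hc.eventually ((e.open_source.inter hSo).mem_nhds ⟨he0, hS0⟩)] with t ht
    have hΞt : Φ t z₀ = e (t, 0) := by simp [hecoe, Ξ]
    rw [hΞt, e.left_inv ht.1]
    refine ⟨⟨e.map_source ht.1, ?_⟩, rfl⟩
    rw [mem_preimage, e.left_inv ht.1]
    exact ht.2

end LevelSets

/-! ### Liouville–Arnold tori -/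

section Torus

variable {d : ℕ} {U : Set (Phase d)} {Z : Fin d → SkewProduct d U}
  {Φ : (Fin d → ℝ) → Phase d → Phase d} {T : Set (Phase d)}

theorem IsLiouvilleArnoldTorus.mem_levelSet_and_eq (hT : IsLiouvilleArnoldTorus Z T) {z : Phase d}
    (hz : z ∈ T) : z ∈ U ∧ T = connectedComponentIn {w ∈ U | ∀ j, (Z j).A w = (Z j).A z} z := by
  obtain ⟨⟨z₁, -, rfl⟩, -, -⟩ := hT
  have h := connectedComponentIn_subset _ _ hz
  refine ⟨h.1, ?_⟩
  rw [connectedComponentIn_eq hz]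
  congr 1
  ext w
  simp [h.2]

theorem IsLiouvilleArnoldTorus.subset (hT : IsLiouvilleArnoldTorus Z T) : T ⊆ U :=
  fun _ hz => (hT.mem_levelSet_and_eq hz).1

theorem IsLiouvilleArnoldTorus.nonempty (hT : IsLiouvilleArnoldTorus Z T) : T.Nonempty := by
  obtain ⟨⟨z, hz, rfl⟩, -, -⟩ := hT
  exact ⟨z, mem_connectedComponentIn ⟨hz, fun _ => rfl⟩⟩

theorem IsLiouvilleArnoldTorus.eq_of_mem {T' : Set (Phase d)} (hT : IsLiouvilleArnoldTorus Z T)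
    (hT' : IsLiouvilleArnoldTorus Z T') {z : Phase d} (hz : z ∈ T) (hz' : z ∈ T') : T = T' :=
  (hT.mem_levelSet_and_eq hz).2.trans (hT'.mem_levelSet_and_eq hz').2.symm

theorem IsLiouvilleArnoldTorus.isPreconnected (hT : IsLiouvilleArnoldTorus Z T) :
    IsPreconnected T := by
  obtain ⟨⟨z, -, rfl⟩, -, -⟩ := hT
  exact isPreconnected_connectedComponentIn

theorem IsLiouvilleArnoldTorus.apply_eq (hT : IsLiouvilleArnoldTorus Z T) {z w : Phase d}
    (hz : z ∈ T) (hw : w ∈ T) (j : Fin d) : (Z j).A w = (Z j).A z := by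
  rw [(hT.mem_levelSet_and_eq hz).2] at hw
  exact (connectedComponentIn_subset _ _ hw).2 j

variable (hU : IsOpen U) (hA : ∀ j k, ∀ z ∈ U, poisson (Z j).A (Z k).A z = 0)
  (hΦ : IsMultiFlowOn (fun j => hamiltonianVectorField (Z j).A) U Φ)
  (hT : IsLiouvilleArnoldTorus Z T)

include hU hA hΦ hT

theorem IsLiouvilleArnoldTorus.flow_mem {z : Phase d} (hz : z ∈ T) (t : Fin d → ℝ) :
    Φ t z ∈ T := by
  obtain ⟨hzU, hTz⟩ := hT.mem_levelSet_and_eq hz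
  have hcont : Continuous fun t => Φ t z :=
    continuous_iff_continuousAt.2 fun t => (hΦ.hasFDerivAt z hzU t).continuousAt
  rw [hTz]
  refine (isPreconnected_range hcont).subset_connectedComponentIn ⟨0, hΦ.zero z hzU⟩ ?_ ⟨t, rfl⟩
  rintro _ ⟨s, rfl⟩
  exact ⟨hΦ.mem z hzU s, fun j => hΦ.conserved hU (fun j => (Z j).smooth_A) hA hzU j s⟩

theorem IsLiouvilleArnoldTorus.exists_local_time {z : Phase d} (hz : z ∈ T) :
    ∃ V : Set (Phase d), IsOpen V ∧ z ∈ V ∧ ∃ τ : Phase d → Fin d → ℝ, ContDiffOn ℝ ∞ τ V ∧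
      (∀ w ∈ T ∩ V, Φ (τ w) z = w ∧ ‖τ w‖ < 1) ∧ ∀ᶠ t in 𝓝 0, τ (Φ t z) = t := by
  have hzU := hT.subset hz
  obtain ⟨V, hV, hzV, τ, hτ, h1, h2⟩ := hΦ.exists_local_time hU (fun j => (Z j).smooth_A) hA hzU
    (hT.2.2 z hz)
  have hτ0 : τ z = 0 := by simpa [hΦ.zero z hzU] using h2.self_of_nhds.2
  refine ⟨V ∩ τ ⁻¹' ball 0 1, hτ.continuousOn.isOpen_inter_preimage hV isOpen_ball,
    ⟨hzV, by simp [hτ0]⟩, τ, hτ.mono inter_subset_left, fun w hw => ?_, h2.mono fun t ht => ht.2⟩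
  exact ⟨h1 w hw.2.1 (hT.apply_eq hz hw.1), by simpa using hw.2.2⟩

theorem IsLiouvilleArnoldTorus.exists_flow_eq {z w : Phase d} (hz : z ∈ T) (hw : w ∈ T) :
    ∃ t, Φ t z = w := by
  choose! V hV hVmem τ hτ hloc _ using
    fun z (hz : z ∈ T) => hT.exists_local_time hU hA hΦ hz
  -- The orbits on `T` are relatively open and partition `T`.
  by_contra hne
  let O : Set (Phase d) := {w | ∃ t, Φ t z = w}
  have hcover : T ⊆ (⋃ y ∈ T ∩ O, V y) ∪ ⋃ y ∈ T \ O, V y := by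
    intro y hy
    by_cases hyO : y ∈ O
    · exact Or.inl (mem_biUnion (x := y) ⟨hy, hyO⟩ (hVmem y hy))
    · exact Or.inr (mem_biUnion (x := y) ⟨hy, hyO⟩ (hVmem y hy))
  obtain ⟨y, hyT, hy1, hy2⟩ := hT.isPreconnected _ _
    (isOpen_biUnion fun y hy => hV y hy.1) (isOpen_biUnion fun y hy => hV y hy.1) hcover
    ⟨z, hz, mem_biUnion (x := z) ⟨hz, 0, hΦ.zero z (hT.subset hz)⟩ (hVmem z hz)⟩
    ⟨w, hw, mem_biUnion (x := w) ⟨hw, hne⟩ (hVmem w hw)⟩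
  obtain ⟨y₁, ⟨hy₁T, t₁, ht₁⟩, hy₁⟩ := mem_iUnion₂.1 hy1
  obtain ⟨y₂, ⟨hy₂T, hy₂O⟩, hy₂⟩ := mem_iUnion₂.1 hy2
  have e1 := (hloc y₁ hy₁T y ⟨hyT, hy₁⟩).1
  have e2 := (hloc y₂ hy₂T y ⟨hyT, hy₂⟩).1
  refine hy₂O ⟨-τ y₂ y + τ y₁ y + t₁, ?_⟩
  rw [hΦ.add z (hT.subset hz), ht₁, hΦ.add y₁ (hT.subset hy₁T), e1]
  nth_rewrite 2 [← e2]
  rw [← hΦ.add y₂ (hT.subset hy₂T), neg_add_cancel, hΦ.zero y₂ (hT.subset hy₂T)]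

theorem IsLiouvilleArnoldTorus.exists_bounded_time {z : Phase d} (hz : z ∈ T) :
    ∃ R : ℝ, ∀ w ∈ T, ∃ t, ‖t‖ ≤ R ∧ Φ t z = w := by
  choose! V hV hVmem τ hτ hloc _ using
    fun z (hz : z ∈ T) => hT.exists_local_time hU hA hΦ hz
  choose! σ hσ using fun w (hw : w ∈ T) => hT.exists_flow_eq hU hA hΦ hz hw
  obtain ⟨F, hFT, hF⟩ := hT.2.1.elim_nhds_subcover V fun y hy => (hV y hy).mem_nhds (hVmem y hy)
  refine ⟨1 + ∑ y ∈ F, ‖σ y‖, fun w hw => ?_⟩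
  obtain ⟨y, hyF, hwy⟩ := mem_iUnion₂.1 (hF hw)
  obtain ⟨e, hlt⟩ := hloc y (hFT y hyF) w ⟨hw, hwy⟩
  refine ⟨τ y w + σ y, ?_, ?_⟩
  · exact (norm_add_le _ _).trans (add_le_add hlt.le
      (Finset.single_le_sum (f := fun y => ‖σ y‖) (fun _ _ => norm_nonneg _) hyF))
  · rw [hΦ.add z (hT.subset hz), hσ y (hFT y hyF), e]

/-- The periods of the action at a point of a Liouville–Arnold torus are the integral combinations
of some basis of `ℝ^d`. -/
theorem IsLiouvilleArnoldTorus.exists_period_basis {z : Phase d} (hz : z ∈ T) :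
    ∃ b : Module.Basis (Fin d) ℝ (Fin d → ℝ),
      ∀ t, Φ t z = z ↔ ∀ i, ∃ k : ℤ, b.repr t i = k := by
  have hzU := hT.subset hz
  let Λ : Submodule ℤ (Fin d → ℝ) := AddSubgroup.toIntSubmodule
    { carrier := {t | Φ t z = z}
      add_mem' := fun {s t} hs ht => by
        change Φ (s + t) z = z
        rw [hΦ.add z hzU, ht, hs]
      zero_mem' := hΦ.zero z hzU
      neg_mem' := fun {t} ht => by
        change Φ (-t) z = z
        have h0 := hΦ.add z hzU (-t) t
        rwa [neg_add_cancel, hΦ.zero z hzU, ht, eq_comm] at h0 }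
  have hΛ : ∀ t, t ∈ Λ ↔ Φ t z = z := fun t => Iff.rfl
  have : DiscreteTopology Λ := by
    obtain ⟨V, -, -, τ, -, -, hinj⟩ := hT.exists_local_time hU hA hΦ hz
    have hτ0 : τ z = 0 := by simpa [hΦ.zero z hzU] using hinj.self_of_nhds
    refine discreteTopology_of_isOpen_singleton_zero (isOpen_singleton_iff_nhds_eq_pure _ |>.2 ?_)
    refine le_antisymm ?_ (pure_le_nhds _)
    rw [le_pure_iff]
    have hev := (continuous_subtype_val (p := (· ∈ Λ))).continuousAt (x := 0) |>.eventually hinj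
    filter_upwards [hev] with t ht
    rw [(hΛ _).1 t.2, hτ0] at ht
    exact Subtype.ext ht.symm
  have : IsZLattice ℝ Λ := by
    refine ⟨?_⟩
    by_contra hne
    -- A functional that vanishes on the periods takes only the values it has on a bounded set of
    -- times, by compactness of `T`, and is therefore zero.
    obtain ⟨f, hf, hle⟩ := Submodule.exists_le_ker_of_lt_top _ (lt_top_iff_ne_top.2 hne)
    obtain ⟨R, hR⟩ := hT.exists_bounded_time hU hA hΦ hz
    have hbound : ∀ t, |f t| ≤ ‖LinearMap.toContinuousLinearMap f‖ * R := fun t => by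
      obtain ⟨k, hk, hkt⟩ := hR _ (hT.flow_mem hU hA hΦ hz t)
      have hmem : -k + t ∈ Λ := by
        rw [hΛ, hΦ.add z hzU, ← hkt, ← hΦ.add z hzU, neg_add_cancel, hΦ.zero z hzU]
      have h0 : f (-k + t) = 0 := hle (Submodule.subset_span hmem)
      have h1 : f t = f k := by
        rw [map_add, map_neg] at h0
        linarith
      rw [h1]
      exact ((LinearMap.toContinuousLinearMap f).le_opNorm k).trans
        (mul_le_mul_of_nonneg_left hk (norm_nonneg _))
    refine hf (LinearMap.ext fun t => ?_)
    by_contra ht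
    obtain ⟨n, hn⟩ := exists_nat_gt (‖LinearMap.toContinuousLinearMap f‖ * R / |f t|)
    rw [div_lt_iff₀ (abs_pos.2 ht)] at hn
    have := hbound ((n : ℝ) • t)
    rw [map_smul, smul_eq_mul, abs_mul, Nat.abs_cast] at this
    exact absurd this (not_le.2 hn)
  have hfree : Module.Free ℤ Λ := ZLattice.module_free ℝ Λ
  have hfin : Module.Finite ℤ Λ := ZLattice.module_finite ℝ Λ
  let b := (Module.finBasisOfFinrankEq ℤ Λ (n := d) (by rw [ZLattice.rank ℝ Λ]; simp))
  refine ⟨b.ofZLatticeBasis ℝ Λ, fun t => ?_⟩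
  have hmem := (b.ofZLatticeBasis ℝ Λ).mem_span_iff_repr_mem ℤ t
  rw [b.ofZLatticeBasis_span ℝ] at hmem
  rw [← hΛ, hmem]
  simp [eq_comm]

theorem IsLiouvilleArnoldTorus.isEmbeddedTorus : IsEmbeddedTorus T := by
  obtain ⟨z, hz⟩ := hT.nonempty
  have hzU := hT.subset hz
  obtain ⟨b, hb⟩ := hT.exists_period_basis hU hA hΦ hz
  have hπ : (2 * Real.pi) ≠ 0 := by positivity
  let l : (Fin d → ℝ) ≃L[ℝ] (Fin d → ℝ) :=
    ((LinearEquiv.smulOfNeZero ℝ _ (2 * Real.pi)⁻¹ (inv_ne_zero hπ)).trans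
      b.equivFun.symm).toContinuousLinearEquiv
  have hl : ∀ u i, b.repr (l u) i = (2 * Real.pi)⁻¹ * u i := fun u i => by
    change b.equivFun (b.equivFun.symm ((2 * Real.pi)⁻¹ • u)) i = _
    rw [LinearEquiv.apply_symm_apply]
    rfl
  have hf := hΦ.contDiff (fun j => contDiffOn_hamiltonianVectorField hU (Z j).smooth_A) hzU
  -- `l` maps `2π` times the standard lattice onto the periods.
  refine ⟨fun u => Φ (l u) z, hf.comp l.contDiff, fun u => ?_, fun u v => ?_, ?_⟩
  · have h1 := HasFDerivAt.comp (g := fun t => Φ t z) u (hΦ.hasFDerivAt z hzU (l u)) l.hasFDerivAt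
    rw [show fderiv ℝ (fun u => Φ (l u) z) u = _ from h1.fderiv]
    exact (injective_sum_smulRight_hamiltonianVectorField
      (hT.2.2 _ (hT.flow_mem hU hA hΦ hz (l u)))).comp l.injective
  · have h1 : Φ (l u) z = Φ (l v) z ↔ Φ (l (v - u)) z = z := by
      rw [map_sub, sub_eq_neg_add, hΦ.add z hzU]
      constructor
      · intro h
        rw [← h, ← hΦ.add z hzU, neg_add_cancel, hΦ.zero z hzU]
      · intro h
        rw [← hΦ.zero _ (hΦ.mem z hzU (l v)), ← add_neg_cancel (l u),
          hΦ.add _ (hΦ.mem z hzU (l v)), h]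
    rw [h1, hb]
    refine forall_congr' fun i => exists_congr fun k => ?_
    rw [hl, Pi.sub_apply, inv_mul_eq_iff_eq_mul₀ hπ, sub_eq_iff_eq_add']
  · refine Subset.antisymm ?_ fun w hw => ?_
    · rintro _ ⟨u, rfl⟩
      exact hT.flow_mem hU hA hΦ hz _
    · obtain ⟨t, rfl⟩ := hT.exists_flow_eq hU hA hΦ hz hw
      exact ⟨l.symm t, by simp⟩

end Torus

/-! ### Latitude circles and the axis field -/

section Latitudes

open InnerProductGeometry

theorem angle_cover (g : SU2) (v w : Spin) : angle (cover g v) (cover g w) = angle v w :=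
  (rotation g).toLinearIsometry.angle_map v w

/-- The point with longitude `w` on the circle of colatitude `θ` about the pole `b 0`. -/
noncomputable def latitudePoint (b : Fin 3 → Spin) (θ : ℝ) (w : ℂ) : Spin :=
  Real.cos θ • b 0 + (Real.sin θ * w.re) • b 1 + (Real.sin θ * w.im) • b 2

/-- The longitude of `s` about the pole `b 0`, if the colatitude of `s` is `θ`
and `sin θ ≠ 0`. -/
noncomputable def longitude (b : Fin 3 → Spin) (θ : ℝ) (s : Spin) : ℂ :=
  ((Real.sin θ)⁻¹ * inner ℝ (b 1) s : ℝ) + ((Real.sin θ)⁻¹ * inner ℝ (b 2) s : ℝ) * Complex.I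

variable (b : OrthonormalBasis (Fin 3) ℝ Spin) {θ : ℝ}

theorem inner_latitudePoint (w : ℂ) : inner ℝ (b 0) (latitudePoint b θ w) = Real.cos θ ∧
    inner ℝ (b 1) (latitudePoint b θ w) = Real.sin θ * w.re ∧
    inner ℝ (b 2) (latitudePoint b θ w) = Real.sin θ * w.im := by
  refine ⟨?_, ?_, ?_⟩ <;>
    simp [latitudePoint, inner_add_right, inner_smul_right,
      orthonormal_iff_ite.1 b.orthonormal]

theorem norm_latitudePoint {w : ℂ} (hw : ‖w‖ = 1) : ‖latitudePoint b θ w‖ = 1 := by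
  have h := b.sum_sq_norm_inner_right (latitudePoint b θ w)
  obtain ⟨h0, h1, h2⟩ := inner_latitudePoint b (θ := θ) w
  have hw' : w.re ^ 2 + w.im ^ 2 = 1 := by
    have := Complex.sq_norm w
    rw [hw, Complex.normSq_apply] at this
    linarith
  rw [Fin.sum_univ_three, h0, h1, h2] at h
  simp only [Real.norm_eq_abs, sq_abs] at h
  have : ‖latitudePoint b θ w‖ ^ 2 = 1 := by
    rw [← h]
    linear_combination Real.sin θ ^ 2 * hw' + Real.sin_sq_add_cos_sq θ
  exact (pow_eq_one_iff_of_nonneg (norm_nonneg _) two_ne_zero).1 this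

theorem angle_latitudePoint (hθ : θ ∈ Icc 0 Real.pi) {w : ℂ} (hw : ‖w‖ = 1) :
    angle (latitudePoint b θ w) (b 0) = θ := by
  rw [angle, real_inner_comm, (inner_latitudePoint b w).1, norm_latitudePoint b hw, b.norm_eq_one,
    mul_one, div_one, Real.arccos_cos hθ.1 hθ.2]

theorem longitude_latitudePoint (hθ : θ ∈ Ioo 0 Real.pi) (w : ℂ) :
    longitude b θ (latitudePoint b θ w) = w := by
  have hsin : Real.sin θ ≠ 0 := (Real.sin_pos_of_mem_Ioo hθ).ne'
  obtain ⟨-, h1, h2⟩ := inner_latitudePoint b (θ := θ) w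
  rw [longitude, h1, h2, inv_mul_cancel_left₀ hsin, inv_mul_cancel_left₀ hsin, Complex.re_add_im]

variable {s : Spin} (hs : ‖s‖ = 1) (hang : angle s (b 0) = θ)
include hs hang

theorem inner_eq_cos_of_angle_eq : inner ℝ (b 0) s = Real.cos θ := by
  rw [← hang, cos_angle, hs, b.norm_eq_one, mul_one, div_one, real_inner_comm]

theorem latitudePoint_longitude (hθ : θ ∈ Ioo 0 Real.pi) :
    latitudePoint b θ (longitude b θ s) = s := by
  have hsin : Real.sin θ ≠ 0 := (Real.sin_pos_of_mem_Ioo hθ).ne'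
  have h := b.sum_repr' s
  rw [Fin.sum_univ_three, inner_eq_cos_of_angle_eq b hs hang] at h
  conv_rhs => rw [← h]
  simp only [latitudePoint, longitude, Complex.add_re, Complex.add_im, Complex.mul_re,
    Complex.mul_im, Complex.ofReal_re, Complex.ofReal_im, Complex.I_re, Complex.I_im, mul_zero,
    mul_one, sub_zero, add_zero, zero_add, mul_inv_cancel_left₀ hsin]

theorem norm_longitude (hθ : θ ∈ Ioo 0 Real.pi) : ‖longitude b θ s‖ = 1 := by
  have hsin : Real.sin θ ≠ 0 := (Real.sin_pos_of_mem_Ioo hθ).ne'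
  have h := b.sum_sq_norm_inner_right s
  rw [Fin.sum_univ_three, inner_eq_cos_of_angle_eq b hs hang, hs] at h
  simp only [Real.norm_eq_abs, sq_abs] at h
  have h2 : ‖longitude b θ s‖ ^ 2 = 1 := by
    rw [Complex.sq_norm, longitude, Complex.normSq_add_mul_I]
    field_simp
    linear_combination h - Real.sin_sq_add_cos_sq θ
  exact (pow_eq_one_iff_of_nonneg (norm_nonneg _) two_ne_zero).1 h2

end Latitudes

section AxisField

variable {d : ℕ} {U : Set (Phase d)} {Z : Fin d → SkewProduct d U}
  {Φ : (Fin d → ℝ) → Phase d → Phase d} {D : Phase d → (Fin d → ℝ) → SU2} {T : Set (Phase d)}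
  {n : Phase d → Spin}

/-- `n` is a field of unit vectors on `T` that is transported by the action. -/
structure IsAxisField (Φ : (Fin d → ℝ) → Phase d → Phase d) (D : Phase d → (Fin d → ℝ) → SU2)
    (T : Set (Phase d)) (n : Phase d → Spin) : Prop where
  norm_eq_one : ∀ z ∈ T, ‖n z‖ = 1
  flow : ∀ z ∈ T, ∀ t, n (Φ t z) = cover (D z t) (n z)

variable (hU : IsOpen U) (hA : ∀ j k, ∀ z ∈ U, poisson (Z j).A (Z k).A z = 0)
  (hΦ : IsSpinAction Z Φ D)

include hU hA hΦ in
/-- The holonomies of the cocycle along the periods of a torus commute in `SU(2)`; transporting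
their common axis gives a well-defined field on the torus. -/
theorem IsLiouvilleArnoldTorus.exists_isAxisField (hT : IsLiouvilleArnoldTorus Z T) :
    ∃ n, IsAxisField Φ D T n := by
  obtain ⟨z, hz⟩ := hT.nonempty
  have hzU := hT.subset hz
  have hper : ∀ s t, Φ t z = z → D z (s + t) = D z s * D z t := fun s t ht => by
    rw [hΦ.cocycle_add z hzU, ht]
  obtain ⟨n₀, hn₀, hfix⟩ := exists_common_axis {g | ∃ t, Φ t z = z ∧ D z t = g} (by
    rintro _ ⟨s, hs, rfl⟩ _ ⟨t, ht, rfl⟩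
    rw [← hper s t ht, ← hper t s hs, add_comm])
  choose! σ hσ using fun w (hw : w ∈ T) => hT.exists_flow_eq hU hA hΦ.flow hz hw
  -- The transported vector does not depend on the time chosen to reach a point.
  have key : ∀ t, cover (D z (σ (Φ t z))) n₀ = cover (D z t) n₀ := fun t => by
    have ht := hσ _ (hT.flow_mem hU hA hΦ.flow hz t)
    have hstab : Φ (-σ (Φ t z) + t) z = z := by
      rw [hΦ.flow.add z hzU]
      nth_rewrite 2 [← ht]
      rw [← hΦ.flow.add z hzU, neg_add_cancel, hΦ.flow.zero z hzU]
    have h := hper (σ (Φ t z)) _ hstab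
    rw [add_neg_cancel_left] at h
    rw [h, cover_mul, hfix _ ⟨_, hstab, rfl⟩]
  refine ⟨fun w => cover (D z (σ w)) n₀, fun w _ => by rw [norm_cover, hn₀], fun w hw t => ?_⟩
  obtain ⟨s, rfl⟩ := hT.exists_flow_eq hU hA hΦ.flow hz hw
  rw [← hΦ.flow.add z hzU, key, key, hΦ.cocycle_add z hzU, cover_mul]

include hΦ in
theorem contDiffOn_cover_cocycle {z : Phase d} (hz : z ∈ U) {V : Set (Phase d)}
    {τ : Phase d → Fin d → ℝ} (hτ : ContDiffOn ℝ ∞ τ V) (v : Spin) :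
    ContDiffOn ℝ ∞ (fun w => cover (D z (τ w)) v) V :=
  (hΦ.contDiff_cover z hz v).comp_contDiffOn hτ

include hU hA hΦ

theorem IsAxisField.isSmoothAlong (hn : IsAxisField Φ D T n) (hT : IsLiouvilleArnoldTorus Z T) :
    IsSmoothAlong T n := by
  intro z hz
  obtain ⟨V, hV, hzV, τ, hτ, hloc, -⟩ := hT.exists_local_time hU hA hΦ.flow hz
  refine ⟨V, hV, hzV, _, contDiffOn_cover_cocycle hΦ (hT.subset hz) hτ (n z), fun w hw => ?_⟩
  rw [← hn.flow z hz, (hloc w hw).1]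

theorem IsAxisField.isSmoothCircleBundle (hn : IsAxisField Φ D T n)
    (hT : IsLiouvilleArnoldTorus Z T) {θ : ℝ} (hθ : θ ∈ Ioo 0 Real.pi) :
    IsSmoothCircleBundle T (latitudeBundle n T θ) := by
  refine ⟨fun q hq => ⟨hq.1, hq.2.1⟩, fun z hz => ?_⟩
  obtain ⟨V, hV, hzV, τ, hτ, hloc, -⟩ := hT.exists_local_time hU hA hΦ.flow hz
  obtain ⟨b, hb⟩ := Orthonormal.exists_orthonormalBasis_extension_of_card_eq (𝕜 := ℝ) (E := Spin)
    (ι := Fin 3) (by simp) (v := fun _ => n z) (s := {0}) (by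
      refine ⟨fun i => hn.norm_eq_one z hz, fun i j hij => absurd (Subsingleton.elim i j) hij⟩)
  have hb0 : b 0 = n z := hb 0 rfl
  have hR := contDiffOn_cover_cocycle hΦ (hT.subset hz) hτ
  have hfst : ∀ E : Type, MapsTo Prod.fst (V ×ˢ (univ : Set E)) V := fun _ _ hq => hq.1
  -- A frame at `z` whose first vector is `n z`, transported along the action, trivializes.
  have hframe : ∀ w ∈ T ∩ V, ∃ b' : OrthonormalBasis (Fin 3) ℝ Spin,
      (b' : Fin 3 → Spin) = (fun i => cover (D z (τ w)) (b i)) ∧ b' 0 = n w := fun w hw => by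
    refine ⟨b.map (rotation (D z (τ w))), funext fun i => by simp [rotation_apply], ?_⟩
    rw [OrthonormalBasis.map_apply, hb0, rotation_apply, ← hn.flow z hz, (hloc w hw).1]
  refine ⟨V, hV, hzV, fun q => latitudePoint (fun i => cover (D z (τ q.1)) (b i)) θ q.2,
    fun q => longitude (fun i => cover (D z (τ q.1)) (b i)) θ q.2, ?_, ?_, fun w hw c hc => ?_,
    fun w hw s hs => ?_⟩
  · have hR' := fun i => (hR (b i)).comp (contDiffOn_fst (s := V ×ˢ (univ : Set ℂ))) (hfst ℂ)
    have hre : ContDiffOn ℝ ∞ (fun q : Phase d × ℂ => Real.sin θ * q.2.re) (V ×ˢ univ) :=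
      (contDiff_const.mul (Complex.reCLM.contDiff.comp contDiff_snd)).contDiffOn
    have him : ContDiffOn ℝ ∞ (fun q : Phase d × ℂ => Real.sin θ * q.2.im) (V ×ˢ univ) :=
      (contDiff_const.mul (Complex.imCLM.contDiff.comp contDiff_snd)).contDiffOn
    exact (((hR' 0).const_smul _).add (hre.smul (hR' 1))).add (him.smul (hR' 2))
  · have hR' := fun i => (hR (b i)).comp (contDiffOn_fst (s := V ×ˢ (univ : Set Spin))) (hfst Spin)
    have hin := fun i => Complex.ofRealCLM.contDiff.comp_contDiffOn
      (contDiffOn_const.mul ((hR' i).inner ℝ contDiffOn_snd) (f := fun _ => (Real.sin θ)⁻¹))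
    exact (hin 1).add ((hin 2).mul contDiffOn_const)
  · obtain ⟨b', hb', hb'0⟩ := hframe w hw
    simp only [← hb']
    refine ⟨⟨hw.1, by simpa [spinSphere] using norm_latitudePoint b' hc, ?_⟩,
      longitude_latitudePoint b' hθ c⟩
    rw [← hb'0]
    exact angle_latitudePoint b' ⟨hθ.1.le, hθ.2.le⟩ hc
  · obtain ⟨b', hb', hb'0⟩ := hframe w hw
    simp only [← hb']
    have hs1 : ‖s‖ = 1 := by simpa [spinSphere] using hs.2.1
    have hang : InnerProductGeometry.angle s (b' 0) = θ := by
      rw [hb'0]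
      exact hs.2.2
    exact ⟨norm_longitude b' hs1 hang hθ, latitudePoint_longitude b' hs1 hang hθ⟩

theorem IsAxisField.flow_mem (hn : IsAxisField Φ D T n) (hT : IsLiouvilleArnoldTorus Z T) {θ : ℝ}
    {q : Phase d × Spin} (hq : q ∈ latitudeBundle n T θ) (t : Fin d → ℝ) :
    (Φ t q.1, cover (D q.1 t) q.2) ∈ latitudeBundle n T θ := by
  refine ⟨hT.flow_mem hU hA hΦ.flow hq.1 t, ?_, ?_⟩
  · have := hq.2.1
    simp only [spinSphere, mem_sphere_zero_iff_norm] at this ⊢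
    rw [norm_cover, this]
  · simp only
    rw [hn.flow _ hq.1, angle_cover, hq.2.2]

theorem IsAxisField.image_flow (hn : IsAxisField Φ D T n) (hT : IsLiouvilleArnoldTorus Z T)
    (θ : ℝ) (j : Fin d) (t : ℝ) :
    (Z j).flow t '' latitudeBundle n T θ = latitudeBundle n T θ := by
  have hflow : ∀ q : Phase d × Spin, q.1 ∈ T → (Z j).flow t q =
      (Φ (Pi.single j t) q.1, cover (D q.1 (Pi.single j t)) q.2) := fun q hq => by
    rw [SkewProduct.flow, hΦ.flow_single _ (hT.subset hq), hΦ.cocycle_single _ (hT.subset hq)]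
  refine Subset.antisymm ?_ fun q hq => ?_
  · rintro _ ⟨q, hq, rfl⟩
    rw [hflow q hq.1]
    exact hn.flow_mem hU hA hΦ hT hq _
  · have hqU := hT.subset hq.1
    have hmem := hn.flow_mem hU hA hΦ hT hq (-Pi.single j t)
    refine ⟨_, hmem, ?_⟩
    rw [hflow _ hmem.1]
    refine Prod.ext ?_ ?_
    · simp only
      rw [← hΦ.flow.add _ hqU, add_neg_cancel, hΦ.flow.zero _ hqU]
    · simp only
      rw [← cover_mul, ← hΦ.cocycle_add _ hqU, add_neg_cancel, hΦ.cocycle_zero hqU]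
      exact cover_eq_self (by simp)

/-- Axis fields on the individual tori combine, because distinct tori are disjoint. -/
theorem exists_isAxisField_forall :
    ∃ n, ∀ T, IsLiouvilleArnoldTorus Z T → IsAxisField Φ D T n := by
  classical
  choose! m hm using fun T (hT : IsLiouvilleArnoldTorus Z T) => hT.exists_isAxisField hU hA hΦ
  let n : Phase d → Spin := fun z =>
    if h : ∃ T, IsLiouvilleArnoldTorus Z T ∧ z ∈ T then m h.choose z else 0
  have hnm : ∀ T, IsLiouvilleArnoldTorus Z T → ∀ z ∈ T, n z = m T z := fun T hT z hz => by
    have h : ∃ T, IsLiouvilleArnoldTorus Z T ∧ z ∈ T := ⟨T, hT, hz⟩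
    simp only [n, dif_pos h]
    rw [h.choose_spec.1.eq_of_mem hT h.choose_spec.2 hz]
  refine ⟨n, fun T hT => ⟨fun z hz => ?_, fun z hz t => ?_⟩⟩
  · rw [hnm T hT z hz, (hm T hT).norm_eq_one z hz]
  · rw [hnm T hT z hz, hnm T hT _ (hT.flow_mem hU hA hΦ.flow hz t), (hm T hT).flow z hz]

end AxisField

end SpinPrecession

theorem theorem2 {d : ℕ} [NeZero d] {U : Set (SpinPrecession.Phase d)} (hU : IsOpen U)
    (Y : SpinPrecession.SkewProduct d U) (Z : Fin d → SpinPrecession.SkewProduct d U)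
    (hZ : SpinPrecession.IsIntegrableBy Y Z) :
    ∃ n : SpinPrecession.Phase d → SpinPrecession.Spin,
      (∀ T, SpinPrecession.IsLiouvilleArnoldTorus Z T →
        SpinPrecession.IsEmbeddedTorus T ∧
        (∀ z ∈ T, n z ∈ SpinPrecession.spinSphere) ∧
        SpinPrecession.IsSmoothAlong T n ∧
        ∀ θ ∈ Set.Icc 0 Real.pi,
          (∀ t : ℝ, Y.flow t '' SpinPrecession.latitudeBundle n T θ =
            SpinPrecession.latitudeBundle n T θ) ∧
          (∀ (j : Fin d) (t : ℝ), (Z j).flow t '' SpinPrecession.latitudeBundle n T θ =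
            SpinPrecession.latitudeBundle n T θ) ∧
          (θ ∈ Set.Ioo 0 Real.pi →
            SpinPrecession.IsSmoothCircleBundle T (SpinPrecession.latitudeBundle n T θ))) ∧
      (⋃ T ∈ {T | SpinPrecession.IsLiouvilleArnoldTorus Z T}, ⋃ θ ∈ Set.Icc 0 Real.pi,
          SpinPrecession.latitudeBundle n T θ) =
        (⋃ T ∈ {T | SpinPrecession.IsLiouvilleArnoldTorus Z T}, T) ×ˢ
          SpinPrecession.spinSphere ∧
      (∀ T T' θ θ', SpinPrecession.IsLiouvilleArnoldTorus Z T →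
        SpinPrecession.IsLiouvilleArnoldTorus Z T' → (T, θ) ≠ (T', θ') →
        Disjoint (SpinPrecession.latitudeBundle n T θ)
          (SpinPrecession.latitudeBundle n T' θ')) := by
  obtain ⟨Φ, D, hΦ⟩ := SpinPrecession.exists_isSpinAction hU Z hZ.involution hZ.spin_involution
  obtain ⟨n, hn⟩ := SpinPrecession.exists_isAxisField_forall hU hZ.involution hΦ
  refine ⟨n, fun T hT => ⟨hT.isEmbeddedTorus hU hZ.involution hΦ.flow, fun z hz => ?_,
    (hn T hT).isSmoothAlong hU hZ.involution hΦ hT, fun θ _ => ⟨fun t => ?_, fun j t => ?_,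
    (hn T hT).isSmoothCircleBundle hU hZ.involution hΦ hT⟩⟩, ?_, fun T T' θ θ' hT hT' hne => ?_⟩
  · simpa [SpinPrecession.spinSphere] using (hn T hT).norm_eq_one z hz
  · rw [← hZ.base]
    exact (hn T hT).image_flow hU hZ.involution hΦ hT θ 0 t
  · exact (hn T hT).image_flow hU hZ.involution hΦ hT θ j t
  · ext q
    simp only [Set.mem_iUnion, Set.mem_ofPred_eq, Set.mem_prod]
    constructor
    · rintro ⟨T, hT, θ, -, hq⟩
      exact ⟨⟨T, hT, hq.1⟩, hq.2.1⟩
    · rintro ⟨⟨T, hT, hq⟩, hs⟩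
      exact ⟨T, hT, _, ⟨InnerProductGeometry.angle_nonneg _ _,
        InnerProductGeometry.angle_le_pi _ _⟩, hq, hs, rfl⟩
  · refine Set.disjoint_left.2 fun q hq hq' => hne ?_
    rw [hT.eq_of_mem hT' hq.1 hq'.1, ← hq.2.2, ← hq'.2.2]
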